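/- Let $n\ge 1$. An Okubo system of type $(n_1,n_2,n_3)$ is a differential system $$(x-T)\frac{dY}{dx}=AY,\qquad T=\mathrm{diag}(t_1I_{n_1},t_2I_{n_2},t_3I_{n_3}),$$ with distinct $t_1,t_2,t_3\in\mathbb C$ and a constant complex block matrix $A=(A_{kl})_{k,l=1}^3$, $A_{kl}\in\mathrm{Mat}(n_k,n_l;\mathbb C)$. Let $A_k$ be the matrix whose $k$-th block row is that of $A$ and whose other rows are zero. The system is irreducible if $A_1,A_2,A_3$ have no common invariant subspace other than $0$ and the whole space. An irreducible Okubo system has type $(\mathrm{II}^*)_{2n}$ [respectively $(\mathrm{III}^*)_{2n+1}$], with exponents $\alpha_i,\beta_j,\gamma,\rho_1,\rho_2$, if $(n_1,n_2,n_3)=(n,n-1,1)$ [resp. $(n,n,1)$], if $A_{11}$ has the $n_1$ mutually distinct eigenvalues $\alpha_i$, $A_{22}$ the $n_2$ mutually distinct eigenvalues $\beta_j$ and $A_{33}=\gamma$, and if $\rho_1\ne\rho_2$ and $A$ is similar to $\mathrm{diag}(\rho_1I_{n},\rho_2I_n)$ [resp. $\mathrm{diag}(\rho_1I_{n+1},\rho_2I_n)$].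 **Theorem 3.1.** Let $\prod_{k\ne i}^m$ denote the product over $1\le k\le m$, $k\ne i$. (1) Every system of type $(\mathrm{II}^*)_{2n}$ or $(\mathrm{III}^*)_{2n+1}$ with exponents $\alpha_i,\beta_j,\gamma,\rho_1,\rho_2$ is transformed, by a change of unknown $Y\mapsto GY$ with a constant invertible $G=\mathrm{diag}(g_1,g_2,g_3)$, $g_k\in\mathrm{GL}(n_k,\mathbb C)$, into $$(x-T)\frac{dY}{dx}=\begin{pmatrix}\alpha&A_{12}&A_{13}\\A_{21}&\beta&A_{23}\\A_{31}&A_{32}&\gamma\end{pmatrix}Y,\qquad \alpha=\mathrm{diag}(\alpha_i),\ \beta=\mathrm{diag}(\beta_j),$$ where in the case $(\mathrm{II}^*)_{2n}$ $$(A_{12})_{ij}=\frac{\prod_{k\ne i}^{n}(\beta_j+\alpha_k-\rho_1-\rho_2)}{\prod_{k\ne j}^{n-1}(\beta_j-\beta_k)},\qquad (A_{13})_i=1,\qquad (A_{23})_i=1,$$ $$(A_{21})_{ij}=(\alpha_j-\rho_1)(\alpha_j-\rho_2)\frac{\prod_{k\ne i}^{n-1}(\alpha_j+\beta_k-\rho_1-\rho_2)}{\prod_{k\ne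 j}^{n}(\alpha_j-\alpha_k)},$$ $$(A_{31})_j=-(\alpha_j-\rho_1)(\alpha_j-\rho_2)\frac{\prod_{k=1}^{n-1}(\alpha_j+\beta_k-\rho_1-\rho_2)}{\prod_{k\ne j}^{n}(\alpha_j-\alpha_k)},\qquad (A_{32})_j=-\frac{\prod_{k=1}^{n}(\beta_j+\alpha_k-\rho_1-\rho_2)}{\prod_{k\ne j}^{n-1}(\beta_j-\beta_k)},$$ and in the case $(\mathrm{III}^*)_{2n+1}$ $$(A_{12})_{ij}=(\beta_j-\rho_1)\frac{\prod_{k\ne i}^{n}(\beta_j+\alpha_k-\rho_1-\rho_2)}{\prod_{k\ne j}^{n}(\beta_j-\beta_k)},\qquad (A_{13})_i=1,\qquad (A_{23})_i=1,$$ $$(A_{21})_{ij}=(\alpha_j-\rho_1)\frac{\prod_{k\ne i}^{n}(\alpha_j+\beta_k-\rho_1-\rho_2)}{\prod_{k\ne j}^{n}(\alpha_j-\alpha_k)},$$ $$(A_{31})_j=-(\alpha_j-\rho_1)\frac{\prod_{k=1}^{n}(\alpha_j+\beta_k-\rho_1-\rho_2)}{\prod_{k\ne j}^{n}(\alpha_j-\alpha_k)},\qquad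 (A_{32})_j=-(\beta_j-\rho_1)\frac{\prod_{k=1}^{n}(\beta_j+\alpha_k-\rho_1-\rho_2)}{\prod_{k\ne j}^{n}(\beta_j-\beta_k)}.$$ (2) For given complex numbers $\alpha_i,\beta_j,\gamma,\rho_1,\rho_2$ (and any distinct $t_1,t_2,t_3$), the displayed canonical form is itself a system of type $(\mathrm{II}^*)_{2n}$ [resp. $(\mathrm{III}^*)_{2n+1}$] with these exponents if and only if the $\alpha_i$ are mutually distinct, the $\beta_j$ are mutually distinct, $\rho_1\ne\rho_2$, $\rho_1,\rho_2\ne0$, $\alpha_i+\beta_j\neq\rho_1+\rho_2$ for all $i,j$, and - in the case $(\mathrm{II}^*)_{2n}$: $\sum_i\alpha_i+\sum_j\beta_j+\gamma=n\rho_1+n\rho_2$ and $\alpha_i\ne\rho_1,\rho_2$ for all $i$; - in the case $(\mathrm{III}^*)_{2n+1}$: $\sum_i\alpha_i+\sum_j\beta_j+\gamma=(n+1)\rho_1+n\rho_2$ and $\alpha_i\ne\rho_1$, $\beta_j\ne\rho_1$ for all $i,j$. -/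

import Mathlib

/-- Positions in a vector of length `n₁ + n₂ + n₃` that is cut into three consecutive blocks. -/
abbrev BlockIdx (n₁ n₂ n₃ : ℕ) : Type := Fin n₁ ⊕ (Fin n₂ ⊕ Fin n₃)

/-- The number (`0`, `1` or `2`) of the block in which a position lies. -/
def BlockIdx.block {n₁ n₂ n₃ : ℕ} : BlockIdx n₁ n₂ n₃ → Fin 3
  | .inl _ => 0
  | .inr (.inl _) => 1
  | .inr (.inr _) => 2

/-- An Okubo system `(x - T) dY/dx = A Y` of type `(n₁, n₂, n₃)`: three distinct finite singular
points and a constant square matrix `A`. -/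
structure OkuboSystem (n₁ n₂ n₃ : ℕ) where
  t : Fin 3 → ℂ
  t_injective : Function.Injective t
  A : Matrix (BlockIdx n₁ n₂ n₃) (BlockIdx n₁ n₂ n₃) ℂ

namespace OkuboSystem

variable {n₁ n₂ n₃ : ℕ}

/-- `T = diag(t₁ I, t₂ I, t₃ I)`. -/
def T (S : OkuboSystem n₁ n₂ n₃) : Matrix (BlockIdx n₁ n₂ n₃) (BlockIdx n₁ n₂ n₃) ℂ :=
  Matrix.diagonal fun p => S.t p.block

/-- `Y` solves `(x - T) dY/dx = A Y` at all points of `U`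
(in the theory, `U` is an open subset of the plane without the three singular points). -/
def IsSolutionOn (S : OkuboSystem n₁ n₂ n₃) (U : Set ℂ) (Y : ℂ → BlockIdx n₁ n₂ n₃ → ℂ) : Prop :=
  ∀ x ∈ U, ∃ Y' : BlockIdx n₁ n₂ n₃ → ℂ, HasDerivAt Y Y' x ∧
    (Matrix.scalar (BlockIdx n₁ n₂ n₃) x - S.T).mulVec Y' = S.A.mulVec (Y x)

/-- The residue matrix `A_k` of the Schlesinger form `dY/dx = ∑ₖ A_k / (x - t_k) Y`: it has the
`k`-th block row of `A`, and its other rows vanish. -/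
def residue (S : OkuboSystem n₁ n₂ n₃) (k : Fin 3) :
    Matrix (BlockIdx n₁ n₂ n₃) (BlockIdx n₁ n₂ n₃) ℂ :=
  Matrix.of fun p q => if p.block = k then S.A p q else 0

/-- Irreducibility of the tuple of residue matrices: no common invariant subspace but `0` and the
whole space. -/
def IsIrreducible (S : OkuboSystem n₁ n₂ n₃) : Prop :=
  ∀ W : Submodule ℂ (BlockIdx n₁ n₂ n₃ → ℂ),
    (∀ k, ∀ v ∈ W, (S.residue k).mulVec v ∈ W) → W = ⊥ ∨ W = ⊤

/-- The diagonal block `A₁₁`. -/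
def A₁₁ (S : OkuboSystem n₁ n₂ n₃) : Matrix (Fin n₁) (Fin n₁) ℂ :=
  S.A.submatrix Sum.inl Sum.inl

/-- The diagonal block `A₂₂`. -/
def A₂₂ (S : OkuboSystem n₁ n₂ n₃) : Matrix (Fin n₂) (Fin n₂) ℂ :=
  S.A.submatrix (fun i => Sum.inr (Sum.inl i)) (fun i => Sum.inr (Sum.inl i))

/-- The diagonal block `A₃₃`. -/
def A₃₃ (S : OkuboSystem n₁ n₂ n₃) : Matrix (Fin n₃) (Fin n₃) ℂ :=
  S.A.submatrix (fun i => Sum.inr (Sum.inr i)) (fun i => Sum.inr (Sum.inr i))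

open Polynomial in
/-- The numbers `e i`, one for each row, are pairwise distinct and are the eigenvalues of `M`. -/
def HasDistinctEigenvalues {n : ℕ} (M : Matrix (Fin n) (Fin n) ℂ) (e : Fin n → ℂ) : Prop :=
  Function.Injective e ∧ M.charpoly = ∏ i, (X - C (e i))

/-- `M` is similar to `diag(ρ₁ I_{m₁}, ρ₂ I_{m₂})`. -/
def IsSimilarToDiag {ι : Type} [Fintype ι] [DecidableEq ι] (M : Matrix ι ι ℂ) (m₁ m₂ : ℕ)
    (ρ₁ ρ₂ : ℂ) : Prop :=
  ∃ (P : Matrix ι (Fin m₁ ⊕ Fin m₂) ℂ) (Q : Matrix (Fin m₁ ⊕ Fin m₂) ι ℂ),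
    P * Q = 1 ∧ Q * P = 1 ∧
      M = P * (Matrix.diagonal (Sum.elim (fun _ => ρ₁) (fun _ => ρ₂)) :
        Matrix (Fin m₁ ⊕ Fin m₂) (Fin m₁ ⊕ Fin m₂) ℂ) * Q

/-- The irreducible Okubo systems with the pair of partitions `(n₁, n₂, n₃)`, `(m₁, m₂)` and with
the characteristic exponents `α`, `β`, `γ` (at the finite singular points), `ρ₁`, `ρ₂`. -/
structure HasType (S : OkuboSystem n₁ n₂ n₃) (m₁ m₂ : ℕ) (α : Fin n₁ → ℂ) (β : Fin n₂ → ℂ)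
    (γ : Fin n₃ → ℂ) (ρ₁ ρ₂ : ℂ) : Prop where
  irreducible : S.IsIrreducible
  exponents₁ : HasDistinctEigenvalues S.A₁₁ α
  exponents₂ : HasDistinctEigenvalues S.A₂₂ β
  exponents₃ : HasDistinctEigenvalues S.A₃₃ γ
  ρ_ne : ρ₁ ≠ ρ₂
  diagonalizable : IsSimilarToDiag S.A m₁ m₂ ρ₁ ρ₂

/-- Type `(II*)_{2n}`: the partitions `(n, n - 1, 1)` and `(n, n)`. -/
def IsTypeIIStar {n : ℕ} (S : OkuboSystem n (n - 1) 1) (α : Fin n → ℂ) (β : Fin (n - 1) → ℂ)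
    (γ ρ₁ ρ₂ : ℂ) : Prop :=
  S.HasType n n α β (fun _ => γ) ρ₁ ρ₂

/-- Type `(III*)_{2n+1}`: the partitions `(n, n, 1)` and `(n + 1, n)`. -/
def IsTypeIIIStar {n : ℕ} (S : OkuboSystem n n 1) (α : Fin n → ℂ) (β : Fin n → ℂ)
    (γ ρ₁ ρ₂ : ℂ) : Prop :=
  S.HasType (n + 1) n α β (fun _ => γ) ρ₁ ρ₂

/-- The block diagonal matrix `diag(g₁, g₂, g₃)`. -/
def blockDiag (g₁ : Matrix (Fin n₁) (Fin n₁) ℂ) (g₂ : Matrix (Fin n₂) (Fin n₂) ℂ)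
    (g₃ : Matrix (Fin n₃) (Fin n₃) ℂ) : Matrix (BlockIdx n₁ n₂ n₃) (BlockIdx n₁ n₂ n₃) ℂ :=
  Matrix.fromBlocks g₁ 0 0 (Matrix.fromBlocks g₂ 0 0 g₃)

/-- `S` is expressed in the form `S'`: the singular points agree, and for a constant invertible
block diagonal matrix `G = diag(g₁, g₂, g₃)` we have `A' = G A G⁻¹`, so that the change of the
unknown `Y ↦ G Y` turns the one differential system into the other. -/
def IsExpressedAs (S S' : OkuboSystem n₁ n₂ n₃) : Prop :=
  S'.t = S.t ∧
    ∃ (g₁ : GL (Fin n₁) ℂ) (g₂ : GL (Fin n₂) ℂ) (g₃ : GL (Fin n₃) ℂ),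
      S'.A = blockDiag g₁.val g₂.val g₃.val * S.A * blockDiag (g₁⁻¹).val (g₂⁻¹).val (g₃⁻¹).val ∧
      ∀ (U : Set ℂ) (Y : ℂ → BlockIdx n₁ n₂ n₃ → ℂ),
        S.IsSolutionOn U Y ↔
          S'.IsSolutionOn U fun x => (blockDiag g₁.val g₂.val g₃.val).mulVec (Y x)

/-- The matrix with diagonal blocks `diag(α)`, `diag(β)`, `γ` and the given off-diagonal blocks,
where the third block has size one. -/
def assemble (α : Fin n₁ → ℂ) (β : Fin n₂ → ℂ) (γ : ℂ)
    (A₁₂ : Fin n₁ → Fin n₂ → ℂ) (A₁₃ : Fin n₁ → ℂ)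
    (A₂₁ : Fin n₂ → Fin n₁ → ℂ) (A₂₃ : Fin n₂ → ℂ)
    (A₃₁ : Fin n₁ → ℂ) (A₃₂ : Fin n₂ → ℂ) :
    Matrix (BlockIdx n₁ n₂ 1) (BlockIdx n₁ n₂ 1) ℂ :=
  Matrix.of fun p q => match p, q with
    | .inl i, .inl j => if i = j then α i else 0
    | .inl i, .inr (.inl j) => A₁₂ i j
    | .inl i, .inr (.inr _) => A₁₃ i
    | .inr (.inl i), .inl j => A₂₁ i j
    | .inr (.inl i), .inr (.inl j) => if i = j then β i else 0
    | .inr (.inl i), .inr (.inr _) => A₂₃ i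
    | .inr (.inr _), .inl j => A₃₁ j
    | .inr (.inr _), .inr (.inl j) => A₃₂ j
    | .inr (.inr _), .inr (.inr _) => γ

open Finset in
/-- The canonical form of type `(II*)_{2n}`. -/
noncomputable def canonicalIIStar {n : ℕ} (t : Fin 3 → ℂ) (ht : Function.Injective t)
    (α : Fin n → ℂ) (β : Fin (n - 1) → ℂ) (γ ρ₁ ρ₂ : ℂ) : OkuboSystem n (n - 1) 1 where
  t := t
  t_injective := ht
  A := assemble α β γ
    -- `A₁₂`
    (fun i j => (∏ k ∈ univ.erase i, (β j + α k - ρ₁ - ρ₂)) / ∏ k ∈ univ.erase j, (β j - β k))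
    -- `A₁₃`
    (fun _ => 1)
    -- `A₂₁`
    (fun i j => (α j - ρ₁) * (α j - ρ₂) *
      ((∏ k ∈ univ.erase i, (α j + β k - ρ₁ - ρ₂)) / ∏ k ∈ univ.erase j, (α j - α k)))
    -- `A₂₃`
    (fun _ => 1)
    -- `A₃₁`
    (fun j => -((α j - ρ₁) * (α j - ρ₂) *
      ((∏ k, (α j + β k - ρ₁ - ρ₂)) / ∏ k ∈ univ.erase j, (α j - α k))))
    -- `A₃₂`
    (fun j => -((∏ k, (β j + α k - ρ₁ - ρ₂)) / ∏ k ∈ univ.erase j, (β j - β k)))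

open Finset in
/-- The canonical form of type `(III*)_{2n+1}`. -/
noncomputable def canonicalIIIStar {n : ℕ} (t : Fin 3 → ℂ) (ht : Function.Injective t)
    (α : Fin n → ℂ) (β : Fin n → ℂ) (γ ρ₁ ρ₂ : ℂ) : OkuboSystem n n 1 where
  t := t
  t_injective := ht
  A := assemble α β γ
    -- `A₁₂`
    (fun i j => (β j - ρ₁) *
      ((∏ k ∈ univ.erase i, (β j + α k - ρ₁ - ρ₂)) / ∏ k ∈ univ.erase j, (β j - β k)))
    -- `A₁₃`
    (fun _ => 1)
    -- `A₂₁`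
    (fun i j => (α j - ρ₁) *
      ((∏ k ∈ univ.erase i, (α j + β k - ρ₁ - ρ₂)) / ∏ k ∈ univ.erase j, (α j - α k)))
    -- `A₂₃`
    (fun _ => 1)
    -- `A₃₁`
    (fun j => -((α j - ρ₁) *
      ((∏ k, (α j + β k - ρ₁ - ρ₂)) / ∏ k ∈ univ.erase j, (α j - α k))))
    -- `A₃₂`
    (fun j => -((β j - ρ₁) *
      ((∏ k, (β j + α k - ρ₁ - ρ₂)) / ∏ k ∈ univ.erase j, (β j - β k))))

end OkuboSystem

/-! ### Partial fractions of `x - γ - ∏ (x - y) / ∏ (x - w j)` -/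

section PartialFractions

open Polynomial Finset

/-! Put `s = ρ₁ + ρ₂` and `p = ρ₁ ρ₂`. As `ρ₁ ≠ ρ₂`, being similar to the prescribed diagonal matrix
means `A² = sA - p` together with the right size and trace. So everything is read off from the
blocks of this quadratic equation.

Diagonalize `A₁₁` and `A₂₂`. The blocks (1,2) and (2,1) then say that `(α i + β j - s)` times an
entry of `A₁₂` or `A₂₁` is minus a product of entries of the last column and the last row.
Irreducibility excludes `α i + β j = s` (`nonresonant_of_irreducible`) and then zeros in the last
column, which can be scaled to 1. Now the matrix is determined by its last row `(u, v)`: it is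
`normalForm`.

The block (1,3) becomes `α i + γ - s = ∑ j, v j / (α i + β j - s)`, and (2,3) is the same for `u`.
This says that `x - γ - ∑ j, v j / (x - β j)` vanishes at the points `s - α i`. Such a rational
function is `∏ (x - y) / ∏ (x - β j)`, where the trace condition supplies the missing root, if any.
Hence `v` consists of explicit residues, unique by interpolation as soon as there are at least as
many equations as unknowns. In type III* this settles `u` too. In type II* there is one equation too
few for `u`, and the diagonal entries of the (1,1) block are used instead: they give `u i` times the
derivative of that rational function at `s - α i`, which is an explicit product
(`crossResidue_derivative`).

Conversely, the residue identities make the canonical matrix satisfy the quadratic equation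
(`normalForm_quadratic`), and the trace fixes the multiplicities. Since `p ≠ 0`, an invariant
subspace is stable under the block projections, hence spanned by coordinate vectors, and the nonzero
last row and column connect all coordinates (`isIrreducible_of_quadratic`). The other inequalities
are necessary because their failure makes a coordinate subspace or the kernel of `A` invariant. -/

lemma degree_prod_X_sub_C_sub_lt {M₁ M₂ : Multiset ℂ} {m : ℕ} (h₁ : M₁.card = m + 1)
    (h₂ : M₂.card = m + 1) (hs : M₁.sum = M₂.sum) :
    ((M₁.map fun y => X - C y).prod - (M₂.map fun y => X - C y).prod).degree < (m : WithBot ℕ) := by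
  -- The two leading coefficients of a monic product are 1 and minus the sum of the roots, so equal
  -- sums cancel both.
  have key : ∀ M : Multiset ℂ, M.card = m + 1 → ∀ k, m ≤ k →
      (M.map fun y => X - C y).prod.coeff k =
        if k = m then -M.sum else if k = m + 1 then 1 else 0 := by
    intro M hM k hk
    have hd : (M.map fun y => X - C y).prod.natDegree = m + 1 := by
      rw [natDegree_multiset_prod_X_sub_C_eq_card, hM]
    split_ifs with h h'
    · have := multiset_prod_X_sub_C_nextCoeff M
      rw [nextCoeff_of_natDegree_pos (by omega), hd] at this
      simpa [h] using this
    · have := monic_multisetProd_X_sub_C M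
      rw [Monic, leadingCoeff, hd] at this
      rw [h', this]
    · exact coeff_eq_zero_of_natDegree_lt (by omega)
  rw [degree_lt_iff_coeff_zero]
  intro k hk
  rw [coeff_sub, key _ h₁ k hk, key _ h₂ k hk, hs, sub_self]

variable {κ : Type*} [Fintype κ]

lemma degree_numerator_lt {w : κ → ℂ} {γ : ℂ} {Y : Multiset ℂ}
    (hY : Y.card = Fintype.card κ + 1) (hs : Y.sum = γ + ∑ j, w j) :
    ((X - C γ) * ∏ j, (X - C (w j)) - (Y.map fun y => X - C y).prod).degree <
      (Fintype.card κ : WithBot ℕ) := by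
  have h := degree_prod_X_sub_C_sub_lt (M₁ := γ ::ₘ univ.val.map w) (M₂ := Y)
    (m := Fintype.card κ) (by simp) hY
    (by rw [hs, Multiset.sum_cons]; rfl)
  rwa [Multiset.map_cons, Multiset.prod_cons, Multiset.map_map] at h

lemma eval_numerator (w : κ → ℂ) (γ : ℂ) (Y : Multiset ℂ) (x : ℂ) :
    ((X - C γ) * ∏ j, (X - C (w j)) - (Y.map fun y => X - C y).prod).eval x =
      (x - γ) * ∏ j, (x - w j) - (Y.map fun y => x - y).prod := by
  simp [eval_prod, eval_multiset_prod, Multiset.map_map]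

variable [DecidableEq κ]

lemma eq_sum_of_degree_lt_card {w : κ → ℂ} (hw : Function.Injective w) {N : ℂ[X]}
    (hN : N.degree < Fintype.card κ) :
    N = ∑ j, C (N.eval (w j) / ∏ k ∈ univ.erase j, (w j - w k)) *
      ∏ k ∈ univ.erase j, (X - C (w k)) := by
  conv_lhs => rw [Lagrange.eq_interpolate (f := N) (s := univ) (v := w) hw.injOn
    (by simpa using hN)]
  rw [Lagrange.interpolate_apply]
  refine sum_congr rfl fun j _ => ?_
  rw [Lagrange.basis]
  simp only [Lagrange.basisDivisor, prod_mul_distrib, div_eq_mul_inv, C_mul, mul_assoc]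
  congr 2
  rw [← map_prod, prod_inv_distrib]

lemma degree_sum_C_mul_prod_erase_lt (w r : κ → ℂ) :
    (∑ j, C (r j) * ∏ k ∈ univ.erase j, (X - C (w k))).degree < Fintype.card κ := by
  refine (degree_sum_le _ _).trans_lt ?_
  rw [Finset.sup_lt_iff (WithBot.bot_lt_coe _)]
  intro j _
  rw [C_mul']
  refine (degree_smul_le _ _).trans_lt ?_
  rw [degree_prod]
  simp only [degree_X_sub_C, sum_const, card_erase_of_mem (mem_univ j), card_univ, nsmul_eq_mul,
    mul_one]
  have : 0 < Fintype.card κ := Fintype.card_pos_iff.2 ⟨j⟩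
  exact_mod_cast (by omega : Fintype.card κ - 1 < Fintype.card κ)

/-- `r` are the residues of the decomposition into partial fractions of
`x - γ - ∏_{y ∈ Y} (x - y) / ∏ j, (x - w j)`. -/
def IsPartialFraction (w : κ → ℂ) (γ : ℂ) (Y : Multiset ℂ) (r : κ → ℂ) : Prop :=
  (X - C γ) * ∏ j, (X - C (w j)) - (Y.map fun y => X - C y).prod =
    ∑ j, C (r j) * ∏ k ∈ univ.erase j, (X - C (w k))

lemma isPartialFraction_residues {w : κ → ℂ} (hw : Function.Injective w) {γ : ℂ}
    {Y : Multiset ℂ} (hY : Y.card = Fintype.card κ + 1) (hs : Y.sum = γ + ∑ j, w j) :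
    IsPartialFraction w γ Y
      fun j => -((Y.map fun y => w j - y).prod / ∏ k ∈ univ.erase j, (w j - w k)) := by
  rw [IsPartialFraction]
  conv_lhs => rw [eq_sum_of_degree_lt_card hw (degree_numerator_lt hY hs)]
  refine sum_congr rfl fun j _ => ?_
  rw [eval_numerator, prod_eq_zero (mem_univ j) (sub_self (w j)), mul_zero, zero_sub, neg_div]

lemma eval_sum_C_mul_prod_erase (w r : κ → ℂ) {x : ℂ} (hx : ∀ j, x ≠ w j) :
    (∑ j, C (r j) * ∏ k ∈ univ.erase j, (X - C (w k))).eval x =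
      (∑ j, r j / (x - w j)) * ∏ j, (x - w j) := by
  rw [eval_finsetSum, sum_mul]
  refine sum_congr rfl fun j _ => ?_
  rw [← mul_prod_erase univ (fun j => x - w j) (mem_univ j)]
  have := sub_ne_zero.2 (hx j)
  simp only [eval_mul, eval_C, eval_prod, eval_sub, eval_X]
  field_simp

lemma IsPartialFraction.eq_at_root {w : κ → ℂ} {γ : ℂ} {Y : Multiset ℂ} {r : κ → ℂ}
    (h : IsPartialFraction w γ Y r) {y : ℂ} (hy : y ∈ Y) (hyw : ∀ j, y ≠ w j) :
    y - γ = ∑ j, r j / (y - w j) := by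
  have h' := congrArg (eval y) h
  rw [eval_numerator, eval_sum_C_mul_prod_erase w r hyw,
    Multiset.prod_eq_zero (Multiset.mem_map.2 ⟨y, hy, sub_self y⟩), sub_zero] at h'
  exact mul_right_cancel₀ (prod_ne_zero_iff.2 fun j _ => sub_ne_zero.2 (hyw j)) h'

/-- The left factor is the derivative at `y` of `x - γ - ∑ j, r j / (x - w j) = ∏ (x - z) / ∏ j, (x
- w j)`. It is obtained algebraically, by dividing the numerator by `X - y` and evaluating at `y`.
-/
lemma IsPartialFraction.derivative_at_root {w : κ → ℂ} {γ : ℂ} {Y : Multiset ℂ} {r : κ → ℂ}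
    {y : ℂ} (h : IsPartialFraction w γ (y ::ₘ Y) r) (hyw : ∀ j, y ≠ w j) :
    (1 + ∑ j, r j / (y - w j) ^ 2) * ∏ j, (y - w j) = (Y.map fun z => y - z).prod := by
  have hr := h.eq_at_root (Multiset.mem_cons_self y Y) hyw
  have key : (X - C y) * (∏ j, (X - C (w j)) +
      ∑ j, C (r j / (y - w j)) * ∏ k ∈ univ.erase j, (X - C (w k))) =
      (X - C y) * (Y.map fun z => X - C z).prod := by
    have h2 : (X - C y) * ∑ j, C (r j / (y - w j)) * ∏ k ∈ univ.erase j, (X - C (w k)) =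
        C (y - γ) * ∏ j, (X - C (w j)) -
          ∑ j, C (r j) * ∏ k ∈ univ.erase j, (X - C (w k)) := by
      rw [hr, map_sum, sum_mul, mul_sum, ← sum_sub_distrib]
      refine sum_congr rfl fun j _ => ?_
      rw [← mul_prod_erase univ (fun j => X - C (w j)) (mem_univ j)]
      have e : C (r j) = C (r j / (y - w j)) * (C y - C (w j)) := by
        rw [← C_sub, ← C_mul, div_mul_cancel₀ _ (sub_ne_zero.2 (hyw j))]
      rw [e]
      ring
    rw [IsPartialFraction, Multiset.map_cons, Multiset.prod_cons] at h
    rw [mul_add, h2, ← h, C_sub]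
    ring
  have h3 := congrArg (eval y) (mul_left_cancel₀ (X_sub_C_ne_zero y) key)
  rw [eval_add, eval_sum_C_mul_prod_erase w _ hyw] at h3
  simp only [eval_prod, eval_multiset_prod, Multiset.map_map, Function.comp_def, eval_sub, eval_X,
    eval_C] at h3
  rw [← h3, add_mul, one_mul]
  simp only [div_div, sq]

/-- After clearing denominators, both sides have degree below the number of poles and agree at no
fewer points, so they coincide; evaluating at a pole recovers its residue. -/
lemma IsPartialFraction.unique {ι : Type*} [Fintype ι] {w : κ → ℂ}
    (hw : Function.Injective w) {γ : ℂ} {Y : Multiset ℂ} {r r' : κ → ℂ}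
    (h : IsPartialFraction w γ Y r) {y : ι → ℂ} (hy : Function.Injective y)
    (hyY : ∀ i, y i ∈ Y) (hyw : ∀ i j, y i ≠ w j) (hc : Fintype.card κ ≤ Fintype.card ι)
    (h' : ∀ i, y i - γ = ∑ j, r' j / (y i - w j)) : r' = r := by
  have e : ∑ j, C (r' j) * ∏ k ∈ univ.erase j, (X - C (w k)) =
      ∑ j, C (r j) * ∏ k ∈ univ.erase j, (X - C (w k)) := by
    refine eq_of_degree_sub_lt_of_eval_finset_eq (univ.image y) ?_ ?_
    · rw [card_image_of_injective _ hy, card_univ]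
      refine ((degree_sub_le _ _).trans_lt (max_lt ?_ ?_)).trans_le (Nat.cast_le.2 hc)
      all_goals exact degree_sum_C_mul_prod_erase_lt w _
    · simp only [mem_image, mem_univ, true_and, forall_exists_index, forall_apply_eq_imp_iff]
      intro i
      rw [eval_sum_C_mul_prod_erase w _ (hyw i), eval_sum_C_mul_prod_erase w _ (hyw i), ← h' i,
        ← h.eq_at_root (hyY i) (hyw i)]
  funext j
  have ev : ∀ r : κ → ℂ, (∑ j, C (r j) * ∏ k ∈ univ.erase j, (X - C (w k))).eval (w j) =
      r j * ∏ k ∈ univ.erase j, (w j - w k) := by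
    intro r
    rw [eval_finsetSum, sum_eq_single j]
    · simp [eval_prod]
    · intro i _ hij
      rw [eval_mul, eval_prod, prod_eq_zero (mem_erase.2 ⟨hij.symm, mem_univ j⟩) (by simp),
        mul_zero]
    · simp
  have e' := congrArg (eval (w j)) e
  rw [ev, ev] at e'
  refine mul_right_cancel₀ (prod_ne_zero_iff.2 fun k hk => sub_ne_zero.2 ?_) e'
  exact fun hjk => (mem_erase.1 hk).1 (hw hjk).symm

end PartialFractions

/-! ### Invariant coordinate subspaces -/

namespace OkuboSystem

open Finset

variable {n₁ n₂ n₃ : ℕ}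

lemma residue_mulVec (S : OkuboSystem n₁ n₂ n₃) (k : Fin 3) (v : BlockIdx n₁ n₂ n₃ → ℂ)
    (p : BlockIdx n₁ n₂ n₃) :
    (S.residue k).mulVec v p = if p.block = k then S.A.mulVec v p else 0 := by
  by_cases h : p.block = k <;> simp [residue, Matrix.mulVec, dotProduct, h]

/-- No proper coordinate subspace is invariant under the matrix of an irreducible system. -/
lemma IsIrreducible.exists_entry_ne_zero {S : OkuboSystem n₁ n₂ n₃} (h : S.IsIrreducible)
    (s : Set (BlockIdx n₁ n₂ n₃)) (hs : s.Nonempty) (hs' : sᶜ.Nonempty) :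
    ∃ p ∉ s, ∃ q ∈ s, S.A p q ≠ 0 := by
  by_contra! hA
  let W : Submodule ℂ (BlockIdx n₁ n₂ n₃ → ℂ) :=
    { carrier := {v | ∀ p ∉ s, v p = 0}
      add_mem' := fun {a b} ha hb p hp => by simp [ha p hp, hb p hp]
      zero_mem' := fun p _ => rfl
      smul_mem' := fun c v hv p hp => by simp [hv p hp] }
  have hW : ∀ k, ∀ v ∈ W, (S.residue k).mulVec v ∈ W := by
    intro k v hv p hp
    rw [residue_mulVec]
    split_ifs
    · rw [Matrix.mulVec, dotProduct]
      refine sum_eq_zero fun q _ => ?_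
      by_cases hq : q ∈ s
      · rw [hA p hp q hq, zero_mul]
      · rw [hv q hq, mul_zero]
    · rfl
  obtain ⟨q, hq⟩ := hs
  obtain ⟨p, hp⟩ := hs'
  rcases h W hW with hW | hW
  · have : Pi.single q (1 : ℂ) ∈ W := fun p hp => Pi.single_eq_of_ne (by rintro rfl; exact hp hq) _
    rw [hW, Submodule.mem_bot] at this
    simpa using congrFun this q
  · have : Pi.single p (1 : ℂ) ∈ W := hW ▸ Submodule.mem_top
    simpa using this p hp

/-! ### Blocks of the quadratic equation and consequences of irreducibility -/

section Quadratic

variable {α : Fin n₁ → ℂ} {β : Fin n₂ → ℂ} {γ : ℂ} {A₁₂ : Fin n₁ → Fin n₂ → ℂ} {A₁₃ : Fin n₁ → ℂ}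
  {A₂₁ : Fin n₂ → Fin n₁ → ℂ} {A₂₃ : Fin n₂ → ℂ} {A₃₁ : Fin n₁ → ℂ} {A₃₂ : Fin n₂ → ℂ} {s p : ℂ}

lemma assemble_sq_11 (i k : Fin n₁) :
    (assemble α β γ A₁₂ A₁₃ A₂₁ A₂₃ A₃₁ A₃₂ * assemble α β γ A₁₂ A₁₃ A₂₁ A₂₃ A₃₁ A₃₂)
      (.inl i) (.inl k) =
      (if i = k then α i ^ 2 else 0) + ∑ j, A₁₂ i j * A₂₁ j k + A₁₃ i * A₃₁ k := by
  by_cases h : i = k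
  · subst h; simp [assemble, Matrix.mul_apply, Fintype.sum_sum_type, sq, add_assoc]
  · simp [assemble, Matrix.mul_apply, Fintype.sum_sum_type, h]

lemma assemble_sq_12 (i : Fin n₁) (k : Fin n₂) :
    (assemble α β γ A₁₂ A₁₃ A₂₁ A₂₃ A₃₁ A₃₂ * assemble α β γ A₁₂ A₁₃ A₂₁ A₂₃ A₃₁ A₃₂)
      (.inl i) (.inr (.inl k)) = (α i + β k) * A₁₂ i k + A₁₃ i * A₃₂ k := by
  simp [assemble, Matrix.mul_apply, Fintype.sum_sum_type]
  ring

lemma assemble_sq_13 (i : Fin n₁) (k : Fin 1) :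
    (assemble α β γ A₁₂ A₁₃ A₂₁ A₂₃ A₃₁ A₃₂ * assemble α β γ A₁₂ A₁₃ A₂₁ A₂₃ A₃₁ A₃₂)
      (.inl i) (.inr (.inr k)) = (α i + γ) * A₁₃ i + ∑ j, A₁₂ i j * A₂₃ j := by
  simp [assemble, Matrix.mul_apply, Fintype.sum_sum_type]
  ring

lemma assemble_sq_21 (i : Fin n₂) (k : Fin n₁) :
    (assemble α β γ A₁₂ A₁₃ A₂₁ A₂₃ A₃₁ A₃₂ * assemble α β γ A₁₂ A₁₃ A₂₁ A₂₃ A₃₁ A₃₂)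
      (.inr (.inl i)) (.inl k) = (α k + β i) * A₂₁ i k + A₂₃ i * A₃₁ k := by
  simp [assemble, Matrix.mul_apply, Fintype.sum_sum_type]
  ring

lemma assemble_sq_22 (i k : Fin n₂) :
    (assemble α β γ A₁₂ A₁₃ A₂₁ A₂₃ A₃₁ A₃₂ * assemble α β γ A₁₂ A₁₃ A₂₁ A₂₃ A₃₁ A₃₂)
      (.inr (.inl i)) (.inr (.inl k)) =
      (if i = k then β i ^ 2 else 0) + ∑ j, A₂₁ i j * A₁₂ j k + A₂₃ i * A₃₂ k := by
  by_cases h : i = k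
  · subst h
    simp [assemble, Matrix.mul_apply, Fintype.sum_sum_type, sq]
    ring
  · simp [assemble, Matrix.mul_apply, Fintype.sum_sum_type, h]

lemma assemble_sq_23 (i : Fin n₂) (k : Fin 1) :
    (assemble α β γ A₁₂ A₁₃ A₂₁ A₂₃ A₃₁ A₃₂ * assemble α β γ A₁₂ A₁₃ A₂₁ A₂₃ A₃₁ A₃₂)
      (.inr (.inl i)) (.inr (.inr k)) = (β i + γ) * A₂₃ i + ∑ j, A₂₁ i j * A₁₃ j := by
  simp [assemble, Matrix.mul_apply, Fintype.sum_sum_type]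
  ring

lemma assemble_sq_31 (i : Fin 1) (k : Fin n₁) :
    (assemble α β γ A₁₂ A₁₃ A₂₁ A₂₃ A₃₁ A₃₂ * assemble α β γ A₁₂ A₁₃ A₂₁ A₂₃ A₃₁ A₃₂)
      (.inr (.inr i)) (.inl k) = (α k + γ) * A₃₁ k + ∑ j, A₃₂ j * A₂₁ j k := by
  simp [assemble, Matrix.mul_apply, Fintype.sum_sum_type]
  ring

lemma assemble_sq_32 (i : Fin 1) (k : Fin n₂) :
    (assemble α β γ A₁₂ A₁₃ A₂₁ A₂₃ A₃₁ A₃₂ * assemble α β γ A₁₂ A₁₃ A₂₁ A₂₃ A₃₁ A₃₂)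
      (.inr (.inr i)) (.inr (.inl k)) = (β k + γ) * A₃₂ k + ∑ j, A₃₁ j * A₁₂ j k := by
  simp [assemble, Matrix.mul_apply, Fintype.sum_sum_type]
  ring

variable (hq : assemble α β γ A₁₂ A₁₃ A₂₁ A₂₃ A₃₁ A₃₂ * assemble α β γ A₁₂ A₁₃ A₂₁ A₂₃ A₃₁ A₃₂ =
  s • assemble α β γ A₁₂ A₁₃ A₂₁ A₂₃ A₃₁ A₃₂ - p • 1)

include hq in
lemma quadratic_11 (i : Fin n₁) :
    α i ^ 2 - s * α i + p + ∑ j, A₁₂ i j * A₂₁ j i + A₁₃ i * A₃₁ i = 0 := by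
  have h := congrFun (congrFun hq (.inl i)) (.inl i)
  rw [assemble_sq_11] at h
  simp [assemble] at h
  linear_combination h

include hq in
lemma quadratic_12 (i : Fin n₁) (j : Fin n₂) :
    (α i + β j - s) * A₁₂ i j + A₁₃ i * A₃₂ j = 0 := by
  have h := congrFun (congrFun hq (.inl i)) (.inr (.inl j))
  rw [assemble_sq_12] at h
  simp [assemble] at h
  linear_combination h

include hq in
lemma quadratic_21 (i : Fin n₁) (j : Fin n₂) :
    (α i + β j - s) * A₂₁ j i + A₂₃ j * A₃₁ i = 0 := by
  have h := congrFun (congrFun hq (.inr (.inl j))) (.inl i)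
  rw [assemble_sq_21] at h
  simp [assemble] at h
  linear_combination h

include hq in
lemma quadratic_13 (i : Fin n₁) : (α i + γ - s) * A₁₃ i + ∑ j, A₁₂ i j * A₂₃ j = 0 := by
  have h := congrFun (congrFun hq (.inl i)) (.inr (.inr 0))
  rw [assemble_sq_13] at h
  simp [assemble] at h
  linear_combination h

include hq in
lemma quadratic_23 (i : Fin n₂) : (β i + γ - s) * A₂₃ i + ∑ j, A₂₁ i j * A₁₃ j = 0 := by
  have h := congrFun (congrFun hq (.inr (.inl i))) (.inr (.inr 0))
  rw [assemble_sq_23] at h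
  simp [assemble] at h
  linear_combination h

variable {S : OkuboSystem n₁ n₂ 1} (hS : S.IsIrreducible)
  (hA : S.A = assemble α β γ A₁₂ A₁₃ A₂₁ A₂₃ A₃₁ A₃₂)
  (hα : Function.Injective α) (hβ : Function.Injective β)

include hq hS hA hα hβ in
-- At a resonance the (1,2) and (2,1) equations degenerate to `A₁₃ i * A₃₂ j = 0` and `A₂₃ j * A₃₁ i
-- = 0`. A vanishing factor kills, through the same equations at the other indices, the rest of a
-- row or column of `A₁₂` or `A₂₁`. In each of the four cases some coordinate subspace becomes
-- invariant.
lemma nonresonant_of_irreducible (i : Fin n₁) (j : Fin n₂) : α i + β j ≠ s := by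
  intro hs
  have e12 := quadratic_12 hq
  have e21 := quadratic_21 hq
  have hj : ∀ j', j' ≠ j → α i + β j' - s ≠ 0 := fun j' hj' h =>
    hj' (hβ (by linear_combination h - hs))
  have hi : ∀ i', i' ≠ i → α i' + β j - s ≠ 0 := fun i' hi' h =>
    hi' (hα (by linear_combination h - hs))
  have r1 : A₁₃ i = 0 → ∀ j', j' ≠ j → A₁₂ i j' = 0 := fun h j' hj' => by
    simpa [h, hj j' hj'] using e12 i j'
  have r2 : A₂₃ j = 0 → ∀ i', i' ≠ i → A₂₁ j i' = 0 := fun h i' hi' => by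
    simpa [h, hi i' hi'] using e21 i' j
  have c1 : A₃₁ i = 0 → ∀ j', j' ≠ j → A₂₁ j' i = 0 := fun h j' hj' => by
    simpa [h, hj j' hj'] using e21 i j'
  have c2 : A₃₂ j = 0 → ∀ i', i' ≠ i → A₁₂ i' j = 0 := fun h i' hi' => by
    simpa [h, hi i' hi'] using e12 i' j
  have d1 : A₁₃ i = 0 ∨ A₃₂ j = 0 := by simpa [hs] using e12 i j
  have d2 : A₂₃ j = 0 ∨ A₃₁ i = 0 := by simpa [hs] using e21 i j
  -- Otherwise rows `i` and `j` are supported on columns `i` and `j`, and the vectors vanishing at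
  -- both positions form an invariant subspace.
  have no_rows : A₁₃ i = 0 → A₂₃ j ≠ 0 := by
    intro h1 h2
    obtain ⟨p, hp, q, hq, h⟩ := hS.exists_entry_ne_zero
      {p | p ≠ .inl i ∧ p ≠ .inr (.inl j)} ⟨.inr (.inr 0), by simp⟩ ⟨.inl i, by simp⟩
    rw [hA] at h
    simp only [ne_eq, Set.mem_ofPred_eq, not_and_or, not_not] at hp hq
    rcases hp with rfl | rfl <;> rcases q with q | q | q <;> simp [assemble] at h hq
    · exact hq h.1.symm
    · exact h (r1 h1 _ hq)
    · exact h h1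
    · exact h (r2 h2 _ hq)
    · exact hq h.1.symm
    · exact h h2
  rcases d1 with h1 | h1 <;> rcases d2 with h2 | h2
  · exact no_rows h1 h2
  -- Row `i` of `A₁₂` is zero away from `j`, so the (1,3) equation reduces to `A₁₂ i j * A₂₃ j = 0`.
  -- Row `i` of the whole matrix is then diagonal.
  · have h3 := quadratic_13 hq i
    rw [sum_eq_single j (fun j' _ hj' => by rw [r1 h1 j' hj', zero_mul]) (by simp), h1, mul_zero,
      zero_add] at h3
    have h4 : A₁₂ i j = 0 := (mul_eq_zero.1 h3).resolve_right (no_rows h1)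
    obtain ⟨p, hp, q, hq, h⟩ := hS.exists_entry_ne_zero
      {p | p ≠ .inl i} ⟨.inr (.inr 0), by simp⟩ ⟨.inl i, by simp⟩
    rw [hA] at h
    simp only [ne_eq, Set.mem_ofPred_eq, not_not] at hp hq
    subst hp
    rcases q with q | q | q <;> simp [assemble] at h hq
    · exact hq h.1.symm
    · by_cases hqj : q = j
      · exact h (hqj ▸ h4)
      · exact h (r1 h1 _ hqj)
    · exact h h1
  · have h3 := quadratic_23 hq j
    rw [sum_eq_single i (fun i' _ hi' => by rw [r2 h2 i' hi', zero_mul]) (by simp), h2, mul_zero,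
      zero_add] at h3
    have h4 : A₂₁ j i = 0 := (mul_eq_zero.1 h3).resolve_right fun h => no_rows h h2
    obtain ⟨p, hp, q, hq, h⟩ := hS.exists_entry_ne_zero
      {p | p ≠ .inr (.inl j)} ⟨.inr (.inr 0), by simp⟩ ⟨.inr (.inl j), by simp⟩
    rw [hA] at h
    simp only [ne_eq, Set.mem_ofPred_eq, not_not] at hp hq
    subst hp
    rcases q with q | q | q <;> simp [assemble] at h hq
    · by_cases hqi : q = i
      · exact h (hqi ▸ h4)
      · exact h (r2 h2 _ hqi)
    · exact hq h.1.symm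
    · exact h h2
  -- Here columns `i` and `j` are supported on rows `i` and `j`, so the two coordinate vectors span
  -- an invariant plane.
  · obtain ⟨p, hp, q, hq, h⟩ := hS.exists_entry_ne_zero
      {p | p = .inl i ∨ p = .inr (.inl j)} ⟨.inl i, by simp⟩ ⟨.inr (.inr 0), by simp⟩
    rw [hA] at h
    simp only [Set.mem_ofPred_eq, not_or] at hp hq
    rcases hq with rfl | rfl <;> rcases p with p | p | p <;> simp [assemble] at h hp
    · exact hp h.1
    · exact h (c1 h2 _ hp)
    · exact h h2
    · exact h (c2 h1 _ hp)
    · exact hp h.1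
    · exact h h1

include hq hS hA in
lemma A₁₃_ne_zero_of_irreducible (hne : ∀ i j, α i + β j ≠ s) (i : Fin n₁) : A₁₃ i ≠ 0 := by
  intro h1
  obtain ⟨p, hp, q, hq', h⟩ := hS.exists_entry_ne_zero
    {p | p ≠ .inl i} ⟨.inr (.inr 0), by simp⟩ ⟨.inl i, by simp⟩
  rw [hA] at h
  simp only [ne_eq, Set.mem_ofPred_eq, not_not] at hp hq'
  subst hp
  rcases q with q | q | q <;> simp [assemble] at h hq'
  · exact hq' h.1.symm
  · have := quadratic_12 hq i q
    rw [h1, zero_mul, add_zero] at this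
    exact mul_ne_zero (sub_ne_zero.2 (hne i q)) h this
  · exact h h1

include hq hS hA in
lemma A₂₃_ne_zero_of_irreducible (hne : ∀ i j, α i + β j ≠ s) (j : Fin n₂) : A₂₃ j ≠ 0 := by
  intro h1
  obtain ⟨p, hp, q, hq', h⟩ := hS.exists_entry_ne_zero
    {p | p ≠ .inr (.inl j)} ⟨.inr (.inr 0), by simp⟩ ⟨.inr (.inl j), by simp⟩
  rw [hA] at h
  simp only [ne_eq, Set.mem_ofPred_eq, not_not] at hp hq'
  subst hp
  rcases q with q | q | q <;> simp [assemble] at h hq'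
  · have := quadratic_21 hq q j
    rw [h1, zero_mul, add_zero] at this
    exact mul_ne_zero (sub_ne_zero.2 (hne q j)) h this
  · exact hq' h.1.symm
  · exact h h1

end Quadratic

/-! ### Matrices determined by their last row -/

section NormalForm

/-- Subtract the equations for `i` and `k` and divide by `z i - z k`. This is the vanishing of the
off-diagonal entries in the (1,1) and (2,2) blocks. -/
lemma sum_div_mul_eq_neg_one {ι κ : Type*} [Fintype κ] {z : ι → ℂ} {w r : κ → ℂ} {γ s : ℂ}
    (hz : Function.Injective z) (hne : ∀ i j, z i + w j ≠ s)
    (h : ∀ i, z i + γ - s = ∑ j, r j / (z i + w j - s)) {i k : ι} (hik : i ≠ k) :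
    ∑ j, r j / ((z i + w j - s) * (z k + w j - s)) = -1 := by
  have hzz : z i - z k ≠ 0 := sub_ne_zero.2 (hz.ne hik)
  refine mul_left_cancel₀ hzz ?_
  have e : (z i - z k) * ∑ j, r j / ((z i + w j - s) * (z k + w j - s)) =
      ∑ j, r j / (z k + w j - s) - ∑ j, r j / (z i + w j - s) := by
    rw [mul_sum, ← sum_sub_distrib]
    refine sum_congr rfl fun j _ => ?_
    have h1 := sub_ne_zero.2 (hne i j)
    have h2 := sub_ne_zero.2 (hne k j)
    field_simp
    ring
  rw [e, ← h, ← h]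
  ring

/-- The matrix whose off-diagonal blocks are expressed by its last row. -/
noncomputable def normalForm (α : Fin n₁ → ℂ) (β : Fin n₂ → ℂ) (γ s : ℂ) (u : Fin n₁ → ℂ)
    (v : Fin n₂ → ℂ) : Matrix (BlockIdx n₁ n₂ 1) (BlockIdx n₁ n₂ 1) ℂ :=
  assemble α β γ (fun i j => -v j / (α i + β j - s)) (fun _ => 1)
    (fun j i => -u i / (α i + β j - s)) (fun _ => 1) u v

variable {α : Fin n₁ → ℂ} {β : Fin n₂ → ℂ} {γ s p : ℂ} {u : Fin n₁ → ℂ} {v : Fin n₂ → ℂ}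

lemma normalForm_quadratic (hn : 0 < n₁) (hα : Function.Injective α)
    (hβ : Function.Injective β) (hne : ∀ i j, α i + β j ≠ s)
    (hv : ∀ i, α i + γ - s = ∑ j, v j / (α i + β j - s))
    (hu : ∀ j, β j + γ - s = ∑ i, u i / (β j + α i - s))
    (hd : ∀ i, α i ^ 2 - s * α i + p + u i * (1 + ∑ j, v j / (α i + β j - s) ^ 2) = 0) :
    normalForm α β γ s u v * normalForm α β γ s u v = s • normalForm α β γ s u v - p • 1 := by
  have hne' : ∀ j i, β j + α i ≠ s := fun j i => by rw [add_comm]; exact hne i j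
  set A := normalForm α β γ s u v with hAdef
  -- The equations for `u` and `v` alone make every off-diagonal entry of `A² - sA + p` vanish.
  obtain ⟨d, hM⟩ : ∃ d, A * A - s • A + p • 1 = Matrix.diagonal d := by
    refine ⟨(A * A - s • A + p • 1).diag, ?_⟩
    ext x y
    by_cases hxy : x = y
    · subst hxy; simp
    rw [Matrix.diagonal_apply_ne _ hxy]
    simp only [Matrix.add_apply, Matrix.sub_apply, Matrix.smul_apply, Matrix.one_apply_ne hxy,
      smul_eq_mul]
    rw [hAdef, normalForm]
    rcases x with i | i | i <;> rcases y with k | k | k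
    · have hik : i ≠ k := fun h => hxy (h ▸ rfl)
      rw [assemble_sq_11]
      have := sum_div_mul_eq_neg_one hα hne hv hik
      have e : ∑ j, -v j / (α i + β j - s) * (-u k / (α k + β j - s)) =
          u k * ∑ j, v j / ((α i + β j - s) * (α k + β j - s)) := by
        rw [mul_sum]
        refine sum_congr rfl fun j _ => ?_
        rw [div_mul_div_comm]
        ring
      rw [e, this]
      simp [assemble, hik]
    · rw [assemble_sq_12]
      have := sub_ne_zero.2 (hne i k)
      simp only [assemble, Matrix.of_apply]
      field_simp
      ring
    · rw [assemble_sq_13]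
      have := hv i
      simp only [assemble, Matrix.of_apply, mul_one, neg_div, sum_neg_distrib]
      linear_combination this
    · rw [assemble_sq_21]
      have := sub_ne_zero.2 (hne k i)
      simp only [assemble, Matrix.of_apply]
      field_simp
      ring
    · have hik : i ≠ k := fun h => hxy (h ▸ rfl)
      rw [assemble_sq_22]
      have := sum_div_mul_eq_neg_one hβ hne' hu hik
      have e : ∑ j, -u j / (α j + β i - s) * (-v k / (α j + β k - s)) =
          v k * ∑ j, u j / ((β i + α j - s) * (β k + α j - s)) := by
        rw [mul_sum]
        refine sum_congr rfl fun j _ => ?_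
        rw [div_mul_div_comm, add_comm (β i), add_comm (β k)]
        ring
      rw [e, this]
      simp [assemble, hik]
    · rw [assemble_sq_23]
      have := hu i
      simp only [assemble, Matrix.of_apply, mul_one, neg_div, sum_neg_distrib]
      simp only [add_comm (α _)]
      linear_combination this
    · rw [assemble_sq_31]
      have e : ∑ j, v j * (-u k / (α k + β j - s)) =
          -u k * ∑ j, v j / (α k + β j - s) := by
        rw [mul_sum]
        exact sum_congr rfl fun j _ => by ring
      rw [e, ← hv k]
      simp only [assemble, Matrix.of_apply]
      ring
    · rw [assemble_sq_32]
      have e : ∑ j, u j * (-v k / (α j + β k - s)) =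
          -v k * ∑ j, u j / (β k + α j - s) := by
        rw [mul_sum]
        exact sum_congr rfl fun j _ => by rw [add_comm (β k)]; ring
      rw [e, ← hu k]
      simp only [assemble, Matrix.of_apply]
      ring
    · exact absurd (by rw [Subsingleton.elim i k]) hxy
  -- A polynomial in `A` commutes with `A`, so `d` takes equal values at two positions joined by a
  -- nonzero entry of `A`. The ones in the last column carry `d = 0` from block 1 to block 3 (this
  -- needs `n₁ > 0`) and on to block 2.
  have hcomm : A * Matrix.diagonal d = Matrix.diagonal d * A := by
    rw [← hM]
    simp [mul_add, mul_sub, add_mul, sub_mul, mul_assoc]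
  have d1 : ∀ i, d (.inl i) = 0 := by
    intro i
    have h := congrFun (congrFun hM (.inl i)) (.inl i)
    rw [Matrix.diagonal_apply_eq] at h
    rw [← h]
    simp only [Matrix.add_apply, Matrix.sub_apply, Matrix.smul_apply, Matrix.one_apply_eq,
      smul_eq_mul, mul_one]
    rw [hAdef, normalForm, assemble_sq_11]
    have e : ∑ j, -v j / (α i + β j - s) * (-u i / (α i + β j - s)) =
        u i * ∑ j, v j / (α i + β j - s) ^ 2 := by
      rw [mul_sum]
      refine sum_congr rfl fun j _ => ?_
      rw [div_mul_div_comm]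
      ring
    rw [e]
    simp only [assemble, Matrix.of_apply, if_true]
    linear_combination hd i
  have d3 : ∀ k, d (.inr (.inr k)) = 0 := by
    intro k
    have h := congrFun (congrFun hcomm (.inl ⟨0, hn⟩)) (.inr (.inr k))
    rw [Matrix.mul_diagonal, Matrix.diagonal_mul, d1] at h
    simpa [hAdef, normalForm, assemble] using h
  have d2 : ∀ j, d (.inr (.inl j)) = 0 := by
    intro j
    have h := congrFun (congrFun hcomm (.inr (.inl j))) (.inr (.inr 0))
    rw [Matrix.mul_diagonal, Matrix.diagonal_mul, d3] at h
    simpa [hAdef, normalForm, assemble] using h.symm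
  have d0 : d = 0 := by
    funext x
    rcases x with i | i | i
    exacts [d1 i, d2 i, d3 i]
  rw [d0, show Matrix.diagonal (0 : BlockIdx n₁ n₂ 1 → ℂ) = 0 from Matrix.diagonal_zero] at hM
  rw [← sub_eq_zero, ← hM]
  abel

lemma assemble_eq_normalForm {A₁₂ : Fin n₁ → Fin n₂ → ℂ} {A₂₁ : Fin n₂ → Fin n₁ → ℂ}
    (hne : ∀ i j, α i + β j ≠ s)
    (hq : assemble α β γ A₁₂ (fun _ => 1) A₂₁ (fun _ => 1) u v *
      assemble α β γ A₁₂ (fun _ => 1) A₂₁ (fun _ => 1) u v =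
      s • assemble α β γ A₁₂ (fun _ => 1) A₂₁ (fun _ => 1) u v - p • 1) :
    assemble α β γ A₁₂ (fun _ => 1) A₂₁ (fun _ => 1) u v = normalForm α β γ s u v ∧
    (∀ i, α i + γ - s = ∑ j, v j / (α i + β j - s)) ∧
    (∀ j, β j + γ - s = ∑ i, u i / (β j + α i - s)) ∧
    ∀ i, α i ^ 2 - s * α i + p + u i * (1 + ∑ j, v j / (α i + β j - s) ^ 2) = 0 := by
  have h12 : A₁₂ = fun i j => -v j / (α i + β j - s) := by
    funext i j
    rw [eq_div_iff (sub_ne_zero.2 (hne i j))]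
    linear_combination quadratic_12 hq i j
  have h21 : A₂₁ = fun j i => -u i / (α i + β j - s) := by
    funext j i
    rw [eq_div_iff (sub_ne_zero.2 (hne i j))]
    linear_combination quadratic_21 hq i j
  refine ⟨by rw [normalForm, h12, h21], fun i => ?_, fun j => ?_, fun i => ?_⟩
  · have := quadratic_13 hq i
    simp only [h12, neg_div, mul_one, sum_neg_distrib] at this
    linear_combination this
  · have := quadratic_23 hq j
    simp only [h21, neg_div, mul_one, sum_neg_distrib, add_comm (α _)] at this
    linear_combination this
  · have := quadratic_11 hq i
    have e : ∑ j, A₁₂ i j * A₂₁ j i = u i * ∑ j, v j / (α i + β j - s) ^ 2 := by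
      rw [mul_sum]
      refine sum_congr rfl fun j _ => ?_
      rw [h12, h21, div_mul_div_comm]
      ring
    rw [e] at this
    linear_combination this

end NormalForm

/-! ### Block diagonal changes of the unknown -/

section Conjugation

lemma blockDiag_mul (g₁ h₁ : Matrix (Fin n₁) (Fin n₁) ℂ) (g₂ h₂ : Matrix (Fin n₂) (Fin n₂) ℂ)
    (g₃ h₃ : Matrix (Fin n₃) (Fin n₃) ℂ) :
    blockDiag g₁ g₂ g₃ * blockDiag h₁ h₂ h₃ = blockDiag (g₁ * h₁) (g₂ * h₂) (g₃ * h₃) := by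
  simp [blockDiag, Matrix.fromBlocks_multiply]

lemma blockDiag_one :
    blockDiag (1 : Matrix (Fin n₁) (Fin n₁) ℂ) (1 : Matrix (Fin n₂) (Fin n₂) ℂ)
      (1 : Matrix (Fin n₃) (Fin n₃) ℂ) = 1 := by
  simp [blockDiag]

lemma blockDiag_mul_inv (g₁ : GL (Fin n₁) ℂ) (g₂ : GL (Fin n₂) ℂ) (g₃ : GL (Fin n₃) ℂ) :
    blockDiag g₁.val g₂.val g₃.val * blockDiag (g₁⁻¹).val (g₂⁻¹).val (g₃⁻¹).val = 1 := by
  rw [blockDiag_mul, Units.mul_inv, Units.mul_inv, Units.mul_inv, blockDiag_one]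

lemma blockDiag_inv_mul (g₁ : GL (Fin n₁) ℂ) (g₂ : GL (Fin n₂) ℂ) (g₃ : GL (Fin n₃) ℂ) :
    blockDiag (g₁⁻¹).val (g₂⁻¹).val (g₃⁻¹).val * blockDiag g₁.val g₂.val g₃.val = 1 := by
  rw [blockDiag_mul, Units.inv_mul, Units.inv_mul, Units.inv_mul, blockDiag_one]

lemma diagonal_mul_blockDiag (f : Fin 3 → ℂ) (g₁ : Matrix (Fin n₁) (Fin n₁) ℂ)
    (g₂ : Matrix (Fin n₂) (Fin n₂) ℂ) (g₃ : Matrix (Fin n₃) (Fin n₃) ℂ) :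
    (Matrix.diagonal fun p : BlockIdx n₁ n₂ n₃ => f p.block) * blockDiag g₁ g₂ g₃ =
      blockDiag g₁ g₂ g₃ * Matrix.diagonal fun p => f p.block := by
  ext p q
  rw [Matrix.diagonal_mul, Matrix.mul_diagonal]
  rcases p with p | p | p <;> rcases q with q | q | q <;>
    simp [blockDiag, BlockIdx.block, mul_comm]

lemma residue_eq (S : OkuboSystem n₁ n₂ n₃) (k : Fin 3) :
    S.residue k =
      (Matrix.diagonal fun p : BlockIdx n₁ n₂ n₃ => (Pi.single k 1 : Fin 3 → ℂ) p.block) * S.A := by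
  ext p q
  rw [Matrix.diagonal_mul]
  by_cases h : p.block = k <;> simp [residue, h]

/-- `A'` is obtained from `A` by a block diagonal change of basis. -/
def IsBlockConj (A A' : Matrix (BlockIdx n₁ n₂ n₃) (BlockIdx n₁ n₂ n₃) ℂ) : Prop :=
  ∃ (g₁ : GL (Fin n₁) ℂ) (g₂ : GL (Fin n₂) ℂ) (g₃ : GL (Fin n₃) ℂ),
    A' = blockDiag g₁.val g₂.val g₃.val * A * blockDiag (g₁⁻¹).val (g₂⁻¹).val (g₃⁻¹).val

lemma IsBlockConj.trans {A A' A'' : Matrix (BlockIdx n₁ n₂ n₃) (BlockIdx n₁ n₂ n₃) ℂ}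
    (h : IsBlockConj A A') (h' : IsBlockConj A' A'') : IsBlockConj A A'' := by
  obtain ⟨g₁, g₂, g₃, rfl⟩ := h
  obtain ⟨h₁, h₂, h₃, rfl⟩ := h'
  refine ⟨h₁ * g₁, h₂ * g₂, h₃ * g₃, ?_⟩
  simp only [mul_inv_rev, Units.val_mul, ← blockDiag_mul, mul_assoc]

lemma IsBlockConj.quadratic {A A' : Matrix (BlockIdx n₁ n₂ n₃) (BlockIdx n₁ n₂ n₃) ℂ} {s p : ℂ}
    (h : IsBlockConj A A') (hA : A * A = s • A - p • 1) : A' * A' = s • A' - p • 1 := by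
  obtain ⟨g₁, g₂, g₃, rfl⟩ := h
  set G := blockDiag g₁.val g₂.val g₃.val
  set G' := blockDiag (g₁⁻¹).val (g₂⁻¹).val (g₃⁻¹).val
  have h1 : G' * G = 1 := blockDiag_inv_mul g₁ g₂ g₃
  have h2 : G * G' = 1 := blockDiag_mul_inv g₁ g₂ g₃
  calc G * A * G' * (G * A * G') = G * A * (G' * G) * A * G' := by simp only [mul_assoc]
    _ = G * (A * A) * G' := by rw [h1, mul_one]; simp only [mul_assoc]
    _ = _ := by rw [hA]; simp [mul_sub, sub_mul, h2]

lemma IsBlockConj.isIrreducible {S S' : OkuboSystem n₁ n₂ n₃} (h : IsBlockConj S.A S'.A)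
    (hS : S.IsIrreducible) : S'.IsIrreducible := by
  obtain ⟨g₁, g₂, g₃, hA⟩ := h
  have hG := fun f => diagonal_mul_blockDiag f g₁.val g₂.val g₃.val
  set G := blockDiag g₁.val g₂.val g₃.val
  set G' := blockDiag (g₁⁻¹).val (g₂⁻¹).val (g₃⁻¹).val
  have h1 : G' * G = 1 := blockDiag_inv_mul g₁ g₂ g₃
  have h2 : G * G' = 1 := blockDiag_mul_inv g₁ g₂ g₃
  intro W hW
  have h3 : ∀ w, G.mulVec (G'.mulVec w) = w := fun w => by
    rw [Matrix.mulVec_mulVec, h2, Matrix.one_mulVec]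
  have hW' : ∀ k, ∀ v ∈ W.comap G.mulVecLin, (S.residue k).mulVec v ∈ W.comap G.mulVecLin := by
    intro k v hv
    have := hW k _ hv
    rw [Submodule.mem_comap]
    convert this using 1
    rw [Matrix.mulVecLin_apply, Matrix.mulVecLin_apply, Matrix.mulVec_mulVec, Matrix.mulVec_mulVec,
      residue_eq, residue_eq, hA]
    congr 1
    rw [← mul_assoc, ← hG]
    simp only [mul_assoc, h1, mul_one]
  rcases hS _ hW' with h | h
  · refine .inl ((Submodule.eq_bot_iff _).2 fun w hw => ?_)
    have : G'.mulVec w ∈ W.comap G.mulVecLin := by simpa [h3] using hw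
    rw [h, Submodule.mem_bot] at this
    rw [← h3 w, this, Matrix.mulVec_zero]
  · refine .inr (Submodule.eq_top_iff'.2 fun w => ?_)
    have : G'.mulVec w ∈ W.comap G.mulVecLin := h ▸ Submodule.mem_top
    simpa [h3] using this

/-- A constant block diagonal matrix commutes with differentiation and with `x - T`, which is scalar
on each block. -/
lemma IsSolutionOn.mulVec {S S' : OkuboSystem n₁ n₂ n₃} (ht : S'.t = S.t)
    (g₁ : Matrix (Fin n₁) (Fin n₁) ℂ) (g₂ : Matrix (Fin n₂) (Fin n₂) ℂ)
    (g₃ : Matrix (Fin n₃) (Fin n₃) ℂ)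
    (hA : S'.A * blockDiag g₁ g₂ g₃ = blockDiag g₁ g₂ g₃ * S.A) {U : Set ℂ}
    {Y : ℂ → BlockIdx n₁ n₂ n₃ → ℂ} (h : S.IsSolutionOn U Y) :
    S'.IsSolutionOn U fun x => (blockDiag g₁ g₂ g₃).mulVec (Y x) := by
  intro x hx
  obtain ⟨Y', hY', e⟩ := h x hx
  refine ⟨(blockDiag g₁ g₂ g₃).mulVec Y',
    (LinearMap.toContinuousLinearMap (blockDiag g₁ g₂ g₃).mulVecLin).hasFDerivAt.comp_hasDerivAt
      x hY', ?_⟩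
  obtain ⟨f, hf⟩ : ∃ f : Fin 3 → ℂ, ∀ k, f k = x - S.t k := ⟨_, fun _ => rfl⟩
  have hT : Matrix.scalar (BlockIdx n₁ n₂ n₃) x - S'.T =
      Matrix.diagonal fun p : BlockIdx n₁ n₂ n₃ => f p.block := by
    simp only [T, ht, Matrix.scalar_apply, Matrix.diagonal_sub, hf]
  have hT' : Matrix.scalar (BlockIdx n₁ n₂ n₃) x - S.T =
      Matrix.diagonal fun p : BlockIdx n₁ n₂ n₃ => f p.block := by
    simp only [T, Matrix.scalar_apply, Matrix.diagonal_sub, hf]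
  rw [Matrix.mulVec_mulVec, Matrix.mulVec_mulVec, hT, hA, diagonal_mul_blockDiag, ← hT',
    ← Matrix.mulVec_mulVec, e, Matrix.mulVec_mulVec]

lemma IsBlockConj.isExpressedAs {S S' : OkuboSystem n₁ n₂ n₃} (ht : S'.t = S.t)
    (h : IsBlockConj S.A S'.A) : S.IsExpressedAs S' := by
  obtain ⟨g₁, g₂, g₃, hA⟩ := h
  refine ⟨ht, g₁, g₂, g₃, hA, fun U Y => ⟨fun h => ?_, fun h => ?_⟩⟩
  · refine h.mulVec ht _ _ _ ?_
    rw [hA, mul_assoc, blockDiag_inv_mul, mul_one]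
  · have := h.mulVec (S' := S) ht.symm (g₁⁻¹).val (g₂⁻¹).val (g₃⁻¹).val ?_
    · simpa only [Matrix.mulVec_mulVec, blockDiag_inv_mul, Matrix.one_mulVec] using this
    · rw [hA, ← mul_assoc, ← mul_assoc, blockDiag_inv_mul, one_mul]

end Conjugation

/-! ### Diagonalization, the quadratic equation and the trace -/

section Diagonalization

lemma HasDistinctEigenvalues.exists_conj_eq_diagonal {n : ℕ} {M : Matrix (Fin n) (Fin n) ℂ}
    {e : Fin n → ℂ} (h : HasDistinctEigenvalues M e) :
    ∃ g : GL (Fin n) ℂ, g.val * M * (g⁻¹).val = Matrix.diagonal e := by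
  have hev : ∀ i, ∃ v, v ≠ 0 ∧ M.mulVec v = e i • v := by
    intro i
    have h0 : (Matrix.scalar (Fin n) (e i) - M).det = 0 := by
      rw [← Matrix.eval_charpoly, h.2, Polynomial.eval_prod]
      exact prod_eq_zero (mem_univ i) (by simp)
    obtain ⟨v, hv, hv'⟩ := Matrix.exists_mulVec_eq_zero_iff.2 h0
    refine ⟨v, hv, ?_⟩
    rw [Matrix.sub_mulVec, sub_eq_zero, Matrix.scalar_apply] at hv'
    rw [← hv']
    ext j
    simp [Matrix.mulVec_diagonal]
  choose v hv hMv using hev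
  have hli : LinearIndependent ℂ v :=
    Module.End.eigenvectors_linearIndependent' M.mulVecLin e h.1 v fun i =>
      ⟨Module.End.mem_eigenspace_iff.2 (hMv i), hv i⟩
  let P : Matrix (Fin n) (Fin n) ℂ := Matrix.of fun p i => v i p
  have hP : IsUnit P := Matrix.linearIndependent_cols_iff_isUnit.1 hli
  obtain ⟨g, hg⟩ := hP
  have hMP : M * g.val = g.val * Matrix.diagonal e := by
    rw [hg]
    ext p i
    rw [Matrix.mul_diagonal]
    have := congrFun (hMv i) p
    simp only [Matrix.mulVec, dotProduct, Pi.smul_apply, smul_eq_mul] at this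
    simp only [Matrix.mul_apply, P, Matrix.of_apply, this, mul_comm]
  refine ⟨g⁻¹, ?_⟩
  rw [inv_inv, mul_assoc, hMP, ← mul_assoc, Units.inv_mul, one_mul]

lemma HasDistinctEigenvalues.eq_of_size_one {M : Matrix (Fin 1) (Fin 1) ℂ} {e : Fin 1 → ℂ}
    (h : HasDistinctEigenvalues M e) : M 0 0 = e 0 := by
  have := congrArg (Polynomial.eval (M 0 0)) h.2
  rw [Matrix.eval_charpoly] at this
  exact sub_eq_zero.1 (by simpa using this.symm)

lemma hasDistinctEigenvalues_diagonal {n : ℕ} {e : Fin n → ℂ} (he : Function.Injective e) :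
    HasDistinctEigenvalues (Matrix.diagonal e) e :=
  ⟨he, Matrix.charpoly_diagonal e⟩

variable {ι : Type} [Fintype ι] [DecidableEq ι] {M : Matrix ι ι ℂ} {m₁ m₂ : ℕ} {ρ₁ ρ₂ : ℂ}

lemma IsSimilarToDiag.quadratic (h : IsSimilarToDiag M m₁ m₂ ρ₁ ρ₂) :
    M * M = (ρ₁ + ρ₂) • M - (ρ₁ * ρ₂) • 1 := by
  obtain ⟨P, Q, hPQ, hQP, rfl⟩ := h
  set D : Matrix (Fin m₁ ⊕ Fin m₂) (Fin m₁ ⊕ Fin m₂) ℂ :=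
    Matrix.diagonal (Sum.elim (fun _ => ρ₁) (fun _ => ρ₂)) with hD
  have hDD : D * D = (ρ₁ + ρ₂) • D - (ρ₁ * ρ₂) • 1 := by
    rw [hD, Matrix.diagonal_mul_diagonal, ← Matrix.diagonal_smul, ← Matrix.diagonal_one,
      ← Matrix.diagonal_smul, Matrix.diagonal_sub]
    congr 1
    funext i
    rcases i with i | i <;> simp <;> ring
  calc P * D * Q * (P * D * Q) = P * D * (Q * P) * D * Q := by simp only [Matrix.mul_assoc]
    _ = P * (D * D) * Q := by rw [hQP, Matrix.mul_one]; simp only [Matrix.mul_assoc]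
    _ = _ := by rw [hDD]; simp [Matrix.mul_sub, Matrix.sub_mul, hPQ]

lemma IsSimilarToDiag.trace (h : IsSimilarToDiag M m₁ m₂ ρ₁ ρ₂) :
    M.trace = m₁ * ρ₁ + m₂ * ρ₂ := by
  obtain ⟨P, Q, hPQ, hQP, rfl⟩ := h
  rw [Matrix.mul_assoc, Matrix.trace_mul_comm, Matrix.mul_assoc, hQP, Matrix.mul_one,
    Matrix.trace_diagonal]
  simp

lemma exists_isSimilarToDiag (hρ : ρ₁ ≠ ρ₂) (hM : M * M = (ρ₁ + ρ₂) • M - (ρ₁ * ρ₂) • 1) :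
    ∃ d₁ d₂, d₁ + d₂ = Fintype.card ι ∧ IsSimilarToDiag M d₁ d₂ ρ₁ ρ₂ := by
  have hρ' : ρ₁ - ρ₂ ≠ 0 := sub_ne_zero.2 hρ
  let K := fun ρ => Module.End.eigenspace M.mulVecLin ρ
  have hK : ∀ ρ v, v ∈ K ρ ↔ M.mulVec v = ρ • v := fun ρ v => Module.End.mem_eigenspace_iff
  have hMM : ∀ v, M.mulVec (M.mulVec v) = (ρ₁ + ρ₂) • M.mulVec v - (ρ₁ * ρ₂) • v := by
    intro v
    rw [Matrix.mulVec_mulVec, hM, Matrix.sub_mulVec, Matrix.smul_mulVec, Matrix.smul_mulVec,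
      Matrix.one_mulVec]
  have hc : IsCompl (K ρ₁) (K ρ₂) := by
    constructor
    · rw [Submodule.disjoint_def]
      intro v h1 h2
      rw [hK] at h1 h2
      have : (ρ₁ - ρ₂) • v = 0 := by rw [sub_smul, ← h1, ← h2, sub_self]
      exact (smul_eq_zero.1 this).resolve_left hρ'
    · rw [codisjoint_iff, Submodule.eq_top_iff']
      intro v
      have e : v = (ρ₁ - ρ₂)⁻¹ • (M.mulVec v - ρ₂ • v) + (-(ρ₁ - ρ₂)⁻¹) • (M.mulVec v - ρ₁ • v) := by
        have : v = ((ρ₁ - ρ₂)⁻¹ * (ρ₁ - ρ₂)) • v := by rw [inv_mul_cancel₀ hρ', one_smul]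
        conv_lhs => rw [this]
        module
      rw [e]
      refine Submodule.add_mem_sup (Submodule.smul_mem _ _ ((hK _ _).2 ?_))
        (Submodule.smul_mem _ _ ((hK _ _).2 ?_))
      all_goals
        rw [Matrix.mulVec_sub, hMM, Matrix.mulVec_smul]
        module
  obtain ⟨d₁, d₂, b, hd, hb⟩ : ∃ (d₁ d₂ : ℕ) (b : Module.Basis (Fin d₁ ⊕ Fin d₂) ℂ (ι → ℂ)),
      d₁ + d₂ = Fintype.card ι ∧
        ∀ j, M.mulVec (b j) = (Sum.elim (fun _ => ρ₁) (fun _ => ρ₂) j : ℂ) • b j := by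
    refine ⟨_, _, ((Module.finBasis ℂ (K ρ₁)).prod (Module.finBasis ℂ (K ρ₂))).map
      (Submodule.prodEquivOfIsCompl _ _ hc), ?_, ?_⟩
    · rw [Submodule.finrank_add_eq_of_isCompl hc, Module.finrank_fintype_fun_eq_card]
    · rintro (j | j) <;> exact (hK _ _).1 (by simp)
  have hMb : M * (Pi.basisFun ℂ ι).toMatrix b = (Pi.basisFun ℂ ι).toMatrix b *
      (Matrix.diagonal (Sum.elim (fun _ => ρ₁) (fun _ => ρ₂)) :
        Matrix (Fin d₁ ⊕ Fin d₂) (Fin d₁ ⊕ Fin d₂) ℂ) := by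
    ext p j
    rw [Matrix.mul_diagonal]
    have := congrFun (hb j) p
    simp only [Matrix.mulVec, dotProduct, Pi.smul_apply, smul_eq_mul] at this
    simp only [Matrix.mul_apply, Module.Basis.toMatrix_apply, Pi.basisFun_repr, this, mul_comm]
  refine ⟨d₁, d₂, hd, (Pi.basisFun ℂ ι).toMatrix b, b.toMatrix (Pi.basisFun ℂ ι),
    Module.Basis.toMatrix_mul_toMatrix_flip _ _, Module.Basis.toMatrix_mul_toMatrix_flip _ _, ?_⟩
  rw [← hMb, Matrix.mul_assoc, Module.Basis.toMatrix_mul_toMatrix_flip, Matrix.mul_one]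

/-- The quadratic equation with distinct roots splits the space into two eigenspaces. Their
dimensions solve a linear system, given by size and trace, with determinant `±(ρ₁ - ρ₂)`. -/
lemma isSimilarToDiag_of_quadratic (hρ : ρ₁ ≠ ρ₂)
    (hM : M * M = (ρ₁ + ρ₂) • M - (ρ₁ * ρ₂) • 1) (hc : m₁ + m₂ = Fintype.card ι)
    (ht : M.trace = m₁ * ρ₁ + m₂ * ρ₂) : IsSimilarToDiag M m₁ m₂ ρ₁ ρ₂ := by
  obtain ⟨d₁, d₂, hd, h⟩ := exists_isSimilarToDiag hρ hM
  have h1 := h.trace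
  rw [ht] at h1
  have h2 : (d₁ : ℂ) + d₂ = m₁ + m₂ := by exact_mod_cast hd.trans hc.symm
  have h3 : (d₁ : ℂ) = m₁ := by
    refine mul_right_cancel₀ (sub_ne_zero.2 hρ) ?_
    linear_combination -h1 - ρ₂ * h2
  have h4 : d₁ = m₁ := by exact_mod_cast h3
  have h5 : d₂ = m₂ := by omega
  rwa [h4, h5] at h

end Diagonalization

/-! ### Irreducibility from the quadratic equation, and nonvanishing of `ρ₁`, `ρ₂` -/

section Irreducibility

/-- Within one block, `A` is diagonal with distinct entries, so the product of `A_k - S.A r r` over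
the other positions `r` of the block isolates one coordinate. -/
lemma single_mem_of_invariant {S : OkuboSystem n₁ n₂ n₃} {W : Submodule ℂ (BlockIdx n₁ n₂ n₃ → ℂ)}
    (hW : ∀ k, ∀ v ∈ W, (S.residue k).mulVec v ∈ W)
    (hproj : ∀ k, ∀ v ∈ W, (fun p => if p.block = k then v p else 0) ∈ W)
    (hdiag : ∀ p q : BlockIdx n₁ n₂ n₃, p.block = q.block → p ≠ q → S.A p q = 0)
    (hinj : ∀ p q : BlockIdx n₁ n₂ n₃, p.block = q.block → S.A p p = S.A q q → p = q)
    {v : BlockIdx n₁ n₂ n₃ → ℂ} (hv : v ∈ W) (p : BlockIdx n₁ n₂ n₃) :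
    Pi.single p (v p) ∈ W := by
  have key : ∀ t : Finset (BlockIdx n₁ n₂ n₃),
      (fun q => if q.block = p.block then (∏ r ∈ t, (S.A q q - S.A r r)) * v q else 0) ∈ W := by
    intro t
    induction t using Finset.induction_on with
    | empty => simpa using hproj p.block v hv
    | insert r t hr ih =>
      have := W.sub_mem (hW p.block _ ih) (W.smul_mem (S.A r r) ih)
      convert this using 1
      funext q
      rw [Pi.sub_apply, residue_mulVec, Pi.smul_apply]
      by_cases hq : q.block = p.block
      · simp only [hq, if_true, Matrix.mulVec, dotProduct, smul_eq_mul]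
        rw [sum_eq_single q]
        · rw [prod_insert hr, if_pos hq]
          ring
        · intro q' _ hqq'
          split_ifs with h
          · rw [hdiag q q' (hq.trans h.symm) hqq'.symm, zero_mul]
          · rw [mul_zero]
        · simp
      · simp [hq]
  let t : Finset (BlockIdx n₁ n₂ n₃) := univ.filter fun r => r.block = p.block ∧ r ≠ p
  have hc : ∏ r ∈ t, (S.A p p - S.A r r) ≠ 0 := by
    refine prod_ne_zero_iff.2 fun r hr h => ?_
    obtain ⟨-, h1, h2⟩ := mem_filter.1 hr
    exact h2 (hinj r p h1 (sub_eq_zero.1 h).symm)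
  have := W.smul_mem (∏ r ∈ t, (S.A p p - S.A r r))⁻¹ (key t)
  convert this using 1
  funext q
  by_cases hq : q = p
  · subst hq
    simp [inv_mul_cancel_left₀ hc]
  · rw [Pi.single_eq_of_ne hq, Pi.smul_apply]
    split_ifs with h
    · have hz : ∏ r ∈ t, (S.A q q - S.A r r) = 0 :=
        prod_eq_zero (i := q) (by simp [t, h, hq]) (sub_self _)
      rw [hz, zero_mul, smul_zero]
    · rw [smul_zero]

lemma isIrreducible_of_quadratic {S : OkuboSystem n₁ n₂ 1} {α : Fin n₁ → ℂ} {β : Fin n₂ → ℂ}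
    {γ s p : ℂ} {A₁₂ : Fin n₁ → Fin n₂ → ℂ} {A₂₁ : Fin n₂ → Fin n₁ → ℂ} {u : Fin n₁ → ℂ}
    {v : Fin n₂ → ℂ} (hA : S.A = assemble α β γ A₁₂ (fun _ => 1) A₂₁ (fun _ => 1) u v)
    (hα : Function.Injective α) (hβ : Function.Injective β) (hu : ∀ i, u i ≠ 0)
    (hv : ∀ j, v j ≠ 0) (hp : p ≠ 0) (hq : S.A * S.A = s • S.A - p • 1) : S.IsIrreducible := by
  intro W hW
  have hAW : ∀ v ∈ W, S.A.mulVec v ∈ W := by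
    intro v hv
    have := W.sum_mem fun k (_ : k ∈ univ) => hW k v hv
    convert this using 1
    funext p
    simp [residue_mulVec]
  have hproj : ∀ k, ∀ v ∈ W, (fun p => if p.block = k then v p else 0) ∈ W := by
    intro k v hv
    -- Row block `k` of `p = sA - A²` expresses the projection onto block `k` as `p⁻¹ (s A_k - A_k
    -- A)`.
    have := W.smul_mem p⁻¹ (W.sub_mem (W.smul_mem s (hW k v hv)) (hW k _ (hAW v hv)))
    convert this using 1
    funext x
    have h := congrFun (congrArg (fun M => Matrix.mulVec M v) hq) x
    simp only [← Matrix.mulVec_mulVec, Matrix.sub_mulVec, Matrix.smul_mulVec, Matrix.one_mulVec,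
      Pi.sub_apply, Pi.smul_apply, smul_eq_mul] at h
    simp only [Pi.smul_apply, Pi.sub_apply, residue_mulVec, smul_eq_mul]
    split_ifs
    · rw [h]
      field_simp
      ring
    · simp
  have hsingle := fun {v} (hv : v ∈ W) => single_mem_of_invariant hW hproj (by
    intro p q hpq hne
    rw [hA]
    rcases p with p | p | p <;> rcases q with q | q | q <;>
      simp [BlockIdx.block, assemble] at hpq hne ⊢
    · exact fun h => absurd h hne
    · exact fun h => absurd h hne
    · exact absurd (Subsingleton.elim p q) hne) (by
    intro p q hpq h
    rw [hA] at h
    rcases p with p | p | p <;> rcases q with q | q | q <;>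
      simp [BlockIdx.block, assemble] at hpq h ⊢
    · exact hα h
    · exact hβ h
    · exact Subsingleton.elim p q) hv
  have hone : ∀ {v p}, v ∈ W → v p ≠ 0 → Pi.single p (1 : ℂ) ∈ W := by
    intro v p hv hvp
    have := W.smul_mem (v p)⁻¹ (hsingle hv p)
    rwa [← Pi.single_smul, smul_eq_mul, inv_mul_cancel₀ hvp] at this
  have hstep : ∀ {p q}, Pi.single p (1 : ℂ) ∈ W → S.A q p ≠ 0 → Pi.single q (1 : ℂ) ∈ W := by
    intro p q hp hqp
    exact hone (hAW _ hp) (by simpa using hqp)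
  by_cases hW0 : W = ⊥
  · exact .inl hW0
  obtain ⟨w, hw, hw0⟩ := W.exists_mem_ne_zero_of_ne_bot hW0
  obtain ⟨p, hwp⟩ := Function.ne_iff.1 hw0
  -- The nonzero last row leads from any coordinate vector to the last one, and the last column of
  -- ones leads back to all the others.
  have h3 : Pi.single (.inr (.inr 0)) (1 : ℂ) ∈ W := by
    have := hone hw hwp
    rcases p with i | j | k
    · exact hstep this (by simpa [hA, assemble] using hu i)
    · exact hstep this (by simpa [hA, assemble] using hv j)
    · rwa [Subsingleton.elim k 0] at this
  have hall : ∀ q, Pi.single q (1 : ℂ) ∈ W := by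
    intro q
    rcases q with i | j | k
    · exact hstep h3 (by simp [hA, assemble])
    · exact hstep h3 (by simp [hA, assemble])
    · rwa [Subsingleton.elim k 0]
  refine .inr (Submodule.eq_top_iff'.2 fun x => ?_)
  rw [← univ_sum_single x]
  refine W.sum_mem fun q _ => ?_
  have := W.smul_mem (x q) (hall q)
  rwa [← Pi.single_smul, smul_eq_mul, mul_one] at this

/-- Every residue matrix kills the kernel of `A`, which is therefore a common invariant subspace. -/
lemma IsIrreducible.ker_eq_bot {S : OkuboSystem n₁ n₂ n₃} (hS : S.IsIrreducible) (hA : S.A ≠ 0)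
    {v : BlockIdx n₁ n₂ n₃ → ℂ} (hv : S.A.mulVec v = 0) : v = 0 := by
  have hker : ∀ k, ∀ v ∈ LinearMap.ker S.A.mulVecLin,
      (S.residue k).mulVec v ∈ LinearMap.ker S.A.mulVecLin := by
    intro k v hv
    have h0 : S.A.mulVec v = 0 := hv
    have : (S.residue k).mulVec v = 0 := by
      funext p
      simp [residue_mulVec, h0]
    rw [this]
    exact Submodule.zero_mem _
  rcases hS _ hker with h | h
  · have : v ∈ LinearMap.ker S.A.mulVecLin := hv
    rwa [h, Submodule.mem_bot] at this
  · refine absurd ?_ hA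
    rw [LinearMap.ker_eq_top] at h
    exact (LinearEquiv.map_eq_zero_iff Matrix.toLin').1 h

lemma IsIrreducible.ne_zero_of_isSimilarToDiag {S : OkuboSystem n₁ n₂ n₃} (hS : S.IsIrreducible)
    (hA : S.A ≠ 0) {m₁ m₂ : ℕ} {ρ₁ ρ₂ : ℂ} (hm₁ : 0 < m₁) (hm₂ : 0 < m₂)
    (h : IsSimilarToDiag S.A m₁ m₂ ρ₁ ρ₂) : ρ₁ ≠ 0 ∧ ρ₂ ≠ 0 := by
  obtain ⟨P, Q, hPQ, hQP, e⟩ := h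
  have key : ∀ i, (Sum.elim (fun _ => ρ₁) (fun _ => ρ₂) : Fin m₁ ⊕ Fin m₂ → ℂ) i ≠ 0 := by
    intro i hi
    have h0 : S.A.mulVec (P.mulVec (Pi.single i 1)) = 0 := by
      rw [e, Matrix.mulVec_mulVec, Matrix.mul_assoc, hQP, Matrix.mul_one, ← Matrix.mulVec_mulVec,
        Matrix.diagonal_mulVec_single, hi, zero_mul, Pi.single_zero, Matrix.mulVec_zero]
    have h1 := hS.ker_eq_bot hA h0
    have h2 := congrArg Q.mulVec h1
    rw [Matrix.mulVec_mulVec, hQP, Matrix.one_mulVec, Matrix.mulVec_zero] at h2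
    simpa using congrFun h2 i
  exact ⟨key (.inl ⟨0, hm₁⟩), key (.inr ⟨0, hm₂⟩)⟩

end Irreducibility

/-! ### The last row of the canonical forms as residues -/

section CrossResidue

/-- The entries of the last row of the canonical forms. -/
noncomputable def crossResidue {m l : ℕ} (ρ₁ ρ₂ : ℂ) (c w : Fin m → ℂ) (z : Fin l → ℂ)
    (j : Fin m) : ℂ :=
  -(c j * ((∏ k, (w j + z k - ρ₁ - ρ₂)) / ∏ k ∈ univ.erase j, (w j - w k)))

variable {m l : ℕ} {ρ₁ ρ₂ γ : ℂ} {c w : Fin m → ℂ} {z : Fin l → ℂ} {E : Multiset ℂ}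

/-- The roots of the numerator are the reflected points `ρ₁ + ρ₂ - z i` and the extra roots `E`,
which produce the prefactor `c`. The condition `hsum`, which will come from the trace, says that the
roots have the sum required for a partial fraction expansion. -/
lemma isPartialFraction_crossResidue (hw : Function.Injective w)
    (hc : ∀ j, c j = (E.map fun e => w j - e).prod) (hcard : l + E.card = m + 1)
    (hsum : ∑ i, z i + ∑ j, w j + γ = l * (ρ₁ + ρ₂) + E.sum) :
    IsPartialFraction w γ (univ.val.map (fun i => ρ₁ + ρ₂ - z i) + E)
      (crossResidue ρ₁ ρ₂ c w z) := by
  have h := isPartialFraction_residues hw (γ := γ)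
    (Y := univ.val.map (fun i => ρ₁ + ρ₂ - z i) + E) (by simpa using hcard) (by
      rw [Multiset.sum_add]
      change ∑ i, (ρ₁ + ρ₂ - z i) + _ = _
      rw [sum_sub_distrib]
      simp only [sum_const, card_univ, Fintype.card_fin, nsmul_eq_mul]
      linear_combination -hsum)
  convert h using 2 with j
  rw [crossResidue, Multiset.map_add, Multiset.prod_add, ← hc, Multiset.map_map]
  have e : ∏ k, (w j + z k - ρ₁ - ρ₂) =
      (univ.val.map ((fun y => w j - y) ∘ fun i => ρ₁ + ρ₂ - z i)).prod := by
    refine prod_congr rfl fun k _ => ?_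
    simp only [Function.comp_apply]
    ring
  rw [e]
  ring

lemma sum_div_reflect (r : Fin m → ℂ) (s x : ℂ) :
    ∑ j, r j / (s - x - w j) = -∑ j, r j / (x + w j - s) := by
  rw [← sum_neg_distrib]
  refine sum_congr rfl fun j _ => ?_
  rw [← div_neg]
  congr 1
  ring

lemma crossResidue_equation
    (h : IsPartialFraction w γ (univ.val.map (fun i => ρ₁ + ρ₂ - z i) + E)
      (crossResidue ρ₁ ρ₂ c w z))
    (hne : ∀ i j, z i + w j ≠ ρ₁ + ρ₂) (i : Fin l) :
    z i + γ - (ρ₁ + ρ₂) = ∑ j, crossResidue ρ₁ ρ₂ c w z j / (z i + w j - (ρ₁ + ρ₂)) := by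
  have := h.eq_at_root (y := ρ₁ + ρ₂ - z i)
    (Multiset.mem_add.2 (.inl (Multiset.mem_map.2 ⟨i, mem_univ i, rfl⟩)))
    (fun j hj => hne i j (by rw [← hj]; ring))
  rw [sum_div_reflect] at this
  linear_combination -this

lemma eq_crossResidue
    (h : IsPartialFraction w γ (univ.val.map (fun i => ρ₁ + ρ₂ - z i) + E)
      (crossResidue ρ₁ ρ₂ c w z))
    (hw : Function.Injective w) (hz : Function.Injective z) (hml : m ≤ l)
    (hne : ∀ i j, z i + w j ≠ ρ₁ + ρ₂) {r : Fin m → ℂ}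
    (hr : ∀ i, z i + γ - (ρ₁ + ρ₂) = ∑ j, r j / (z i + w j - (ρ₁ + ρ₂))) :
    r = crossResidue ρ₁ ρ₂ c w z := by
  refine h.unique (y := fun i => ρ₁ + ρ₂ - z i) hw (fun i j hij => hz (sub_right_injective hij))
    (fun i => Multiset.mem_add.2 (.inl (Multiset.mem_map.2 ⟨i, mem_univ i, rfl⟩)))
    (fun i j hj => hne i j ?_) (by simpa using hml) fun i => ?_
  · rw [← hj]; ring
  · rw [sum_div_reflect]
    linear_combination -(hr i)

/-- This is `derivative_at_root` at the simple factor `ρ₁ + ρ₂ - z i`; the signs from reflecting all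
factors cancel because `m = l - 1 + E.card`. -/
lemma crossResidue_derivative
    (h : IsPartialFraction w γ (univ.val.map (fun i => ρ₁ + ρ₂ - z i) + E)
      (crossResidue ρ₁ ρ₂ c w z))
    (hcard : l + E.card = m + 1) (hne : ∀ i j, z i + w j ≠ ρ₁ + ρ₂) (i : Fin l) :
    (1 + ∑ j, crossResidue ρ₁ ρ₂ c w z j / (z i + w j - (ρ₁ + ρ₂)) ^ 2) *
        ∏ j, (z i + w j - ρ₁ - ρ₂) =
      (∏ k ∈ univ.erase i, (z i - z k)) * (E.map fun e => z i + e - ρ₁ - ρ₂).prod := by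
  have hY : (univ.val.map (fun i => ρ₁ + ρ₂ - z i) + E) =
      (ρ₁ + ρ₂ - z i) ::ₘ ((univ.erase i).val.map (fun i => ρ₁ + ρ₂ - z i) + E) := by
    rw [← Multiset.cons_add, ← Multiset.map_cons (fun i => ρ₁ + ρ₂ - z i),
      ← insert_val_of_notMem (notMem_erase i univ), insert_erase (mem_univ i)]
  rw [hY] at h
  have hd := h.derivative_at_root (fun j hj => hne i j (by rw [← hj]; ring))
  rw [Multiset.map_add, Multiset.prod_add, Multiset.map_map] at hd
  have e1 : ∏ j, (ρ₁ + ρ₂ - z i - w j) = (-1) ^ m * ∏ j, (z i + w j - ρ₁ - ρ₂) := by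
    have : (-1 : ℂ) ^ m = ∏ _j : Fin m, (-1 : ℂ) := by simp
    rw [this, ← prod_mul_distrib]
    exact prod_congr rfl fun j _ => by ring
  have e2 : ((univ.erase i).val.map ((fun y => ρ₁ + ρ₂ - z i - y) ∘ fun i => ρ₁ + ρ₂ - z i)).prod =
      (-1) ^ (l - 1) * ∏ k ∈ univ.erase i, (z i - z k) := by
    have : (-1 : ℂ) ^ (l - 1) = ∏ _j ∈ univ.erase i, (-1 : ℂ) := by simp
    rw [this, ← prod_mul_distrib]
    refine prod_congr rfl fun j _ => ?_
    simp only [Function.comp_apply]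
    ring
  have e3 : (E.map fun e => ρ₁ + ρ₂ - z i - e).prod =
      (-1) ^ E.card * (E.map fun e => z i + e - ρ₁ - ρ₂).prod := by
    have : (-1 : ℂ) ^ E.card = (E.map fun _ => (-1 : ℂ)).prod := by simp
    rw [this, ← Multiset.prod_map_mul]
    exact congrArg _ (Multiset.map_congr rfl fun e _ => by ring)
  have e4 : ∀ j, crossResidue ρ₁ ρ₂ c w z j / (ρ₁ + ρ₂ - z i - w j) ^ 2 =
      crossResidue ρ₁ ρ₂ c w z j / (z i + w j - (ρ₁ + ρ₂)) ^ 2 := fun j => by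
    congr 1; ring
  rw [e1, e2, e3] at hd
  simp only [e4] at hd
  have hl : 0 < l := i.pos
  have hm : m = l - 1 + E.card := by omega
  have hpow : (-1 : ℂ) ^ m ≠ 0 := pow_ne_zero _ (by norm_num)
  refine mul_left_cancel₀ hpow ?_
  have hpow' : (-1 : ℂ) ^ m = (-1) ^ (l - 1) * (-1) ^ E.card := by rw [← pow_add, ← hm]
  rw [mul_left_comm, hd, hpow']
  ring

lemma crossResidue_ne_zero (hw : Function.Injective w) (hne : ∀ i j, z i + w j ≠ ρ₁ + ρ₂)
    {j : Fin m} (hc : c j ≠ 0) : crossResidue ρ₁ ρ₂ c w z j ≠ 0 := by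
  refine neg_ne_zero.2 (mul_ne_zero hc (div_ne_zero ?_ ?_)) <;> refine prod_ne_zero_iff.2 ?_
  · intro k _ h
    exact hne k j (by linear_combination h)
  · intro k hk h
    exact (mem_erase.1 hk).1 (hw (sub_eq_zero.1 h)).symm

lemma neg_crossResidue_div (hne : ∀ i j, z i + w j ≠ ρ₁ + ρ₂) (i : Fin l) (j : Fin m) :
    -crossResidue ρ₁ ρ₂ c w z j / (z i + w j - (ρ₁ + ρ₂)) =
      c j * ((∏ k ∈ univ.erase i, (w j + z k - ρ₁ - ρ₂)) / ∏ k ∈ univ.erase j, (w j - w k)) := by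
  rw [crossResidue, neg_neg, ← mul_prod_erase univ (fun k => w j + z k - ρ₁ - ρ₂) (mem_univ i),
    div_eq_iff (sub_ne_zero.2 (hne i j))]
  ring

end CrossResidue

/-! ### Reduction to the normal form, and the conditions on the exponents -/

section Canonical

variable {ρ₁ ρ₂ γ : ℂ} {α : Fin n₁ → ℂ} {β : Fin n₂ → ℂ} {a : Fin n₁ → ℂ} {b : Fin n₂ → ℂ}

/-- The common shape of the matrices of the two canonical forms. -/
noncomputable def canonicalMatrix (ρ₁ ρ₂ γ : ℂ) (α : Fin n₁ → ℂ) (β : Fin n₂ → ℂ)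
    (a : Fin n₁ → ℂ) (b : Fin n₂ → ℂ) : Matrix (BlockIdx n₁ n₂ 1) (BlockIdx n₁ n₂ 1) ℂ :=
  assemble α β γ
    (fun i j => b j *
      ((∏ k ∈ univ.erase i, (β j + α k - ρ₁ - ρ₂)) / ∏ k ∈ univ.erase j, (β j - β k)))
    (fun _ => 1)
    (fun i j => a j *
      ((∏ k ∈ univ.erase i, (α j + β k - ρ₁ - ρ₂)) / ∏ k ∈ univ.erase j, (α j - α k)))
    (fun _ => 1) (crossResidue ρ₁ ρ₂ a α β) (crossResidue ρ₁ ρ₂ b β α)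

lemma canonicalMatrix_eq_normalForm (hne : ∀ i j, α i + β j ≠ ρ₁ + ρ₂) :
    canonicalMatrix ρ₁ ρ₂ γ α β a b =
      normalForm α β γ (ρ₁ + ρ₂) (crossResidue ρ₁ ρ₂ a α β) (crossResidue ρ₁ ρ₂ b β α) := by
  rw [canonicalMatrix, normalForm]
  congr 1
  · funext i j
    exact (neg_crossResidue_div hne i j).symm
  · funext j i
    rw [add_comm (α i)]
    exact (neg_crossResidue_div (fun j i => by rw [add_comm]; exact hne i j) j i).symm

lemma trace_assemble {A₁₂ : Fin n₁ → Fin n₂ → ℂ} {A₁₃ : Fin n₁ → ℂ} {A₂₁ : Fin n₂ → Fin n₁ → ℂ}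
    {A₂₃ : Fin n₂ → ℂ} {A₃₁ : Fin n₁ → ℂ} {A₃₂ : Fin n₂ → ℂ} :
    (assemble α β γ A₁₂ A₁₃ A₂₁ A₂₃ A₃₁ A₃₂).trace = ∑ i, α i + ∑ j, β j + γ := by
  simp [Matrix.trace, assemble, Fintype.sum_sum_type, add_assoc]

variable {S : OkuboSystem n₁ n₂ 1}

/-- The factor `a i` divides every off-diagonal entry of column `i`; if it is zero, the coordinate
vector spans an invariant line. -/
lemma IsIrreducible.canonical_first_ne_zero (hS : S.IsIrreducible)
    (hA : S.A = canonicalMatrix ρ₁ ρ₂ γ α β a b) (i : Fin n₁) : a i ≠ 0 := by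
  intro h0
  obtain ⟨p, hp, q, hq, h⟩ := hS.exists_entry_ne_zero {.inl i} ⟨_, rfl⟩ ⟨.inr (.inr 0), by simp⟩
  rw [Set.mem_singleton_iff] at hp hq
  subst hq
  rw [hA] at h
  rcases p with p | p | p <;>
    simp [canonicalMatrix, assemble, crossResidue, h0] at h hp
  exact hp h.1

lemma IsIrreducible.canonical_second_ne_zero (hS : S.IsIrreducible)
    (hA : S.A = canonicalMatrix ρ₁ ρ₂ γ α β a b) (j : Fin n₂) : b j ≠ 0 := by
  intro h0
  obtain ⟨p, hp, q, hq, h⟩ :=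
    hS.exists_entry_ne_zero {.inr (.inl j)} ⟨_, rfl⟩ ⟨.inr (.inr 0), by simp⟩
  rw [Set.mem_singleton_iff] at hp hq
  subst hq
  rw [hA] at h
  rcases p with p | p | p <;>
    simp [canonicalMatrix, assemble, crossResidue, h0] at h hp
  exact hp h.1

/-- A vanishing `α i + β j - ρ₁ - ρ₂` occurs as a factor in all entries of columns `i` and `j`
outside rows `i` and `j`, leaving an invariant plane. -/
lemma IsIrreducible.canonical_nonresonant (hS : S.IsIrreducible)
    (hA : S.A = canonicalMatrix ρ₁ ρ₂ γ α β a b) (i : Fin n₁) (j : Fin n₂) :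
    α i + β j ≠ ρ₁ + ρ₂ := by
  intro h0
  have h1 : α i + β j - ρ₁ - ρ₂ = 0 := by linear_combination h0
  have h2 : β j + α i - ρ₁ - ρ₂ = 0 := by linear_combination h0
  obtain ⟨p, hp, q, hq, h⟩ := hS.exists_entry_ne_zero
    {p | p = .inl i ∨ p = .inr (.inl j)} ⟨_, .inl rfl⟩ ⟨.inr (.inr 0), by simp⟩
  simp only [Set.mem_ofPred_eq, not_or] at hp hq
  rw [hA] at h
  rcases hq with rfl | rfl <;> rcases p with p | p | p <;>
    simp only [canonicalMatrix, assemble, crossResidue, Matrix.of_apply] at h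
  · exact hp.1 (by simpa using (ite_ne_right_iff.1 h).1)
  · have hpj : j ≠ p := fun e => hp.2 (by rw [e])
    rw [prod_eq_zero (mem_erase.2 ⟨hpj, mem_univ j⟩) h1, zero_div, mul_zero] at h
    exact h rfl
  · rw [prod_eq_zero (mem_univ j) h1, zero_div, mul_zero, neg_zero] at h
    exact h rfl
  · have hpi : i ≠ p := fun e => hp.1 (by rw [e])
    rw [prod_eq_zero (mem_erase.2 ⟨hpi, mem_univ i⟩) h2, zero_div, mul_zero] at h
    exact h rfl
  · exact hp.2 (by simpa using (ite_ne_right_iff.1 h).1)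
  · rw [prod_eq_zero (mem_univ i) h2, zero_div, mul_zero, neg_zero] at h
    exact h rfl

variable {m₁ m₂ : ℕ}

lemma HasType.canonical_conditions (h : S.HasType m₁ m₂ α β (fun _ => γ) ρ₁ ρ₂)
    (hA : S.A = canonicalMatrix ρ₁ ρ₂ γ α β a b) (hn : 0 < n₁) (hm₁ : 0 < m₁) (hm₂ : 0 < m₂) :
    Function.Injective α ∧ Function.Injective β ∧ ρ₁ ≠ ρ₂ ∧ ρ₁ ≠ 0 ∧ ρ₂ ≠ 0 ∧
      ∑ i, α i + ∑ j, β j + γ = m₁ * ρ₁ + m₂ * ρ₂ ∧ (∀ i, a i ≠ 0) ∧ (∀ j, b j ≠ 0) ∧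
      ∀ i j, α i + β j ≠ ρ₁ + ρ₂ := by
  have hA0 : S.A ≠ 0 := by
    intro h0
    have := congrFun (congrFun h0 (.inl ⟨0, hn⟩)) (.inr (.inr 0))
    simp [hA, canonicalMatrix, assemble] at this
  obtain ⟨h1, h2⟩ := h.irreducible.ne_zero_of_isSimilarToDiag hA0 hm₁ hm₂ h.diagonalizable
  refine ⟨h.exponents₁.1, h.exponents₂.1, h.ρ_ne, h1, h2, ?_,
    h.irreducible.canonical_first_ne_zero hA, h.irreducible.canonical_second_ne_zero hA,
    h.irreducible.canonical_nonresonant hA⟩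
  rw [← h.diagonalizable.trace, hA, canonicalMatrix, trace_assemble]

/-- `Ea` and `Eb` are the roots of the prefactors `a` and `b`. The condition `hab` makes the residue
`u i`, multiplied by the derivative computed from `v`, equal to `-(α i - ρ₁) (α i - ρ₂)`, as the
diagonal of the (1,1) block demands. -/
lemma hasType_of_canonical (hn : 0 < n₁) (hA : S.A = canonicalMatrix ρ₁ ρ₂ γ α β a b)
    {Ea Eb : Multiset ℂ} (ha : ∀ i, a i = (Ea.map fun e => α i - e).prod)
    (hb : ∀ j, b j = (Eb.map fun e => β j - e).prod)
    (hEa : n₂ + Ea.card = n₁ + 1) (hEb : n₁ + Eb.card = n₂ + 1)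
    (hsa : ∑ i, α i + ∑ j, β j + γ = n₂ * (ρ₁ + ρ₂) + Ea.sum)
    (hsb : ∑ i, α i + ∑ j, β j + γ = n₁ * (ρ₁ + ρ₂) + Eb.sum)
    (hab : ∀ i, a i * (Eb.map fun e => α i + e - ρ₁ - ρ₂).prod = (α i - ρ₁) * (α i - ρ₂))
    (hα : Function.Injective α) (hβ : Function.Injective β) (hρ : ρ₁ ≠ ρ₂) (h₁ : ρ₁ ≠ 0)
    (h₂ : ρ₂ ≠ 0) (hm : m₁ + m₂ = n₁ + n₂ + 1)
    (hs : ∑ i, α i + ∑ j, β j + γ = m₁ * ρ₁ + m₂ * ρ₂)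
    (ha0 : ∀ i, a i ≠ 0) (hb0 : ∀ j, b j ≠ 0) (hne : ∀ i j, α i + β j ≠ ρ₁ + ρ₂) :
    S.HasType m₁ m₂ α β (fun _ => γ) ρ₁ ρ₂ := by
  have hne' : ∀ j i, β j + α i ≠ ρ₁ + ρ₂ := fun j i => by rw [add_comm]; exact hne i j
  have pfb : IsPartialFraction β γ (univ.val.map (fun i => ρ₁ + ρ₂ - α i) + Eb)
      (crossResidue ρ₁ ρ₂ b β α) := isPartialFraction_crossResidue hβ hb hEb hsb
  have pfa : IsPartialFraction α γ (univ.val.map (fun j => ρ₁ + ρ₂ - β j) + Ea)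
      (crossResidue ρ₁ ρ₂ a α β) :=
    isPartialFraction_crossResidue hα ha hEa (by rw [← hsa]; ring)
  have hq : S.A * S.A = (ρ₁ + ρ₂) • S.A - (ρ₁ * ρ₂) • 1 := by
    rw [hA, canonicalMatrix_eq_normalForm hne]
    refine normalForm_quadratic hn hα hβ hne (crossResidue_equation pfb hne)
      (crossResidue_equation pfa hne') fun i => ?_
    have hA' : ∏ k ∈ univ.erase i, (α i - α k) ≠ 0 := prod_ne_zero_iff.2 fun k hk h =>
      (mem_erase.1 hk).1 (hα (sub_eq_zero.1 h)).symm
    have hd := crossResidue_derivative pfb hEb hne i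
    set D := 1 + ∑ j, crossResidue ρ₁ ρ₂ b β α j / (α i + β j - (ρ₁ + ρ₂)) ^ 2
    have e : crossResidue ρ₁ ρ₂ a α β i * D = -((α i - ρ₁) * (α i - ρ₂)) := by
      rw [← hab, crossResidue]
      field_simp
      linear_combination -(a i) * hd
    rw [e]
    ring
  refine ⟨?_, ?_, ?_, ?_, hρ, ?_⟩
  · exact isIrreducible_of_quadratic hA hα hβ (fun i => crossResidue_ne_zero hα hne' (ha0 i))
      (fun j => crossResidue_ne_zero hβ hne (hb0 j)) (mul_ne_zero h₁ h₂) hq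
  · convert hasDistinctEigenvalues_diagonal hα using 1
    ext i j
    simp [A₁₁, hA, canonicalMatrix, assemble, Matrix.diagonal_apply]
  · convert hasDistinctEigenvalues_diagonal hβ using 1
    ext i j
    simp [A₂₂, hA, canonicalMatrix, assemble, Matrix.diagonal_apply]
  · convert hasDistinctEigenvalues_diagonal (e := fun _ : Fin 1 => γ)
      (Function.injective_of_subsingleton _) using 1
    ext i j
    simp [A₃₃, hA, canonicalMatrix, assemble, Subsingleton.elim i j]
  · refine isSimilarToDiag_of_quadratic hρ hq ?_ ?_
    · simp only [Fintype.card_sum, Fintype.card_fin]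
      omega
    · rw [hA, canonicalMatrix, trace_assemble, hs]

lemma HasType.exists_isBlockConj_assemble (h : S.HasType m₁ m₂ α β (fun _ => γ) ρ₁ ρ₂) :
    ∃ A₁₂ A₁₃ A₂₁ A₂₃ A₃₁ A₃₂,
      IsBlockConj S.A (assemble α β γ A₁₂ A₁₃ A₂₁ A₂₃ A₃₁ A₃₂) := by
  obtain ⟨g₁, h₁⟩ := h.exponents₁.exists_conj_eq_diagonal
  obtain ⟨g₂, h₂⟩ := h.exponents₂.exists_conj_eq_diagonal
  have h₃ := h.exponents₃.eq_of_size_one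
  let A' := blockDiag g₁.val g₂.val (1 : GL (Fin 1) ℂ).val * S.A *
    blockDiag (g₁⁻¹).val (g₂⁻¹).val ((1 : GL (Fin 1) ℂ)⁻¹).val
  refine ⟨fun i j => A' (.inl i) (.inr (.inl j)), fun i => A' (.inl i) (.inr (.inr 0)),
    fun i j => A' (.inr (.inl i)) (.inl j), fun i => A' (.inr (.inl i)) (.inr (.inr 0)),
    fun j => A' (.inr (.inr 0)) (.inl j), fun j => A' (.inr (.inr 0)) (.inr (.inl j)),
    g₁, g₂, 1, ?_⟩
  change _ = A'
  ext p q
  rcases p with i | i | i <;> rcases q with j | j | j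
  · have := congrFun (congrFun h₁ i) j
    rw [Matrix.diagonal_apply] at this
    simp only [assemble, Matrix.of_apply]
    rw [← this]
    simp [A', blockDiag, A₁₁, Matrix.mul_apply, Fintype.sum_sum_type]
  · rfl
  · rw [Subsingleton.elim j 0]; rfl
  · rfl
  · have := congrFun (congrFun h₂ i) j
    rw [Matrix.diagonal_apply] at this
    simp only [assemble, Matrix.of_apply]
    rw [← this]
    simp [A', blockDiag, A₂₂, Matrix.mul_apply, Fintype.sum_sum_type]
  · rw [Subsingleton.elim j 0]; rfl
  · rw [Subsingleton.elim i 0]; rfl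
  · rw [Subsingleton.elim i 0]; rfl
  · rw [Subsingleton.elim i 0, Subsingleton.elim j 0]
    simp only [assemble, Matrix.of_apply]
    rw [← h₃]
    simp [A', blockDiag, A₃₃, Matrix.mul_apply, Fintype.sum_sum_type]

/-- Conjugation by diagonal matrices preserves the diagonal blocks, and the inverses of the last
column's entries scale it to 1. -/
lemma isBlockConj_assemble_one {A₁₂ : Fin n₁ → Fin n₂ → ℂ} {A₁₃ : Fin n₁ → ℂ}
    {A₂₁ : Fin n₂ → Fin n₁ → ℂ} {A₂₃ : Fin n₂ → ℂ} {A₃₁ : Fin n₁ → ℂ} {A₃₂ : Fin n₂ → ℂ}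
    (h₁₃ : ∀ i, A₁₃ i ≠ 0) (h₂₃ : ∀ j, A₂₃ j ≠ 0) :
    ∃ A₁₂' A₂₁' u v, IsBlockConj (assemble α β γ A₁₂ A₁₃ A₂₁ A₂₃ A₃₁ A₃₂)
      (assemble α β γ A₁₂' (fun _ => 1) A₂₁' (fun _ => 1) u v) := by
  have hdiag : ∀ {m : ℕ} (d : Fin m → ℂ), (∀ i, d i ≠ 0) → ∃ g : GL (Fin m) ℂ,
      g.val = Matrix.diagonal (fun i => (d i)⁻¹) ∧ (g⁻¹).val = Matrix.diagonal d := by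
    intro m d hd
    refine ⟨⟨Matrix.diagonal (fun i => (d i)⁻¹), Matrix.diagonal d, ?_, ?_⟩, rfl, rfl⟩ <;>
      simp [Matrix.diagonal_mul_diagonal, hd]
  obtain ⟨g₁, hg₁, hg₁'⟩ := hdiag A₁₃ h₁₃
  obtain ⟨g₂, hg₂, hg₂'⟩ := hdiag A₂₃ h₂₃
  refine ⟨fun i j => (A₁₃ i)⁻¹ * A₁₂ i j * A₂₃ j, fun j i => (A₂₃ j)⁻¹ * A₂₁ j i * A₁₃ i,
    fun i => A₃₁ i * A₁₃ i, fun j => A₃₂ j * A₂₃ j, g₁, g₂, 1, ?_⟩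
  have e1 : blockDiag g₁.val g₂.val (1 : GL (Fin 1) ℂ).val = Matrix.diagonal
      (Sum.elim (fun i => (A₁₃ i)⁻¹) (Sum.elim (fun j => (A₂₃ j)⁻¹) fun _ => 1)) := by
    rw [hg₁, hg₂, blockDiag, Units.val_one, ← Matrix.diagonal_one, Matrix.fromBlocks_diagonal,
      Matrix.fromBlocks_diagonal]
  have e2 : blockDiag (g₁⁻¹).val (g₂⁻¹).val ((1 : GL (Fin 1) ℂ)⁻¹).val = Matrix.diagonal
      (Sum.elim A₁₃ (Sum.elim A₂₃ fun _ => 1)) := by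
    rw [hg₁', hg₂', blockDiag, inv_one, Units.val_one, ← Matrix.diagonal_one,
      Matrix.fromBlocks_diagonal, Matrix.fromBlocks_diagonal]
  rw [e1, e2]
  ext p q
  rw [Matrix.mul_diagonal, Matrix.diagonal_mul]
  rcases p with i | i | i <;> rcases q with j | j | j <;> simp [assemble, h₁₃, h₂₃]
  all_goals
    split_ifs with hij
    · subst hij
      field_simp [h₁₃, h₂₃]
    · rfl

lemma HasType.exists_isBlockConj_normalForm (h : S.HasType m₁ m₂ α β (fun _ => γ) ρ₁ ρ₂) :
    ∃ u v, IsBlockConj S.A (normalForm α β γ (ρ₁ + ρ₂) u v) ∧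
      (∀ i j, α i + β j ≠ ρ₁ + ρ₂) ∧
      (∑ i, α i + ∑ j, β j + γ = m₁ * ρ₁ + m₂ * ρ₂) ∧
      (∀ i, α i + γ - (ρ₁ + ρ₂) = ∑ j, v j / (α i + β j - (ρ₁ + ρ₂))) ∧
      (∀ j, β j + γ - (ρ₁ + ρ₂) = ∑ i, u i / (β j + α i - (ρ₁ + ρ₂))) ∧
      ∀ i, α i ^ 2 - (ρ₁ + ρ₂) * α i + ρ₁ * ρ₂ +
        u i * (1 + ∑ j, v j / (α i + β j - (ρ₁ + ρ₂)) ^ 2) = 0 := by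
  obtain ⟨A₁₂, A₁₃, A₂₁, A₂₃, A₃₁, A₃₂, hc⟩ := h.exists_isBlockConj_assemble
  have hq := hc.quadratic h.diagonalizable.quadratic
  let S' : OkuboSystem n₁ n₂ 1 := ⟨S.t, S.t_injective, assemble α β γ A₁₂ A₁₃ A₂₁ A₂₃ A₃₁ A₃₂⟩
  have hS' : S'.IsIrreducible := IsBlockConj.isIrreducible (S := S) hc h.irreducible
  have hne : ∀ i j, α i + β j ≠ ρ₁ + ρ₂ :=
    nonresonant_of_irreducible hq hS' rfl h.exponents₁.1 h.exponents₂.1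
  obtain ⟨A₁₂', A₂₁', u, v, hc'⟩ := isBlockConj_assemble_one (α := α) (β := β) (γ := γ)
    (A₁₂ := A₁₂) (A₂₁ := A₂₁) (A₃₁ := A₃₁) (A₃₂ := A₃₂)
    (A₁₃_ne_zero_of_irreducible hq hS' rfl hne) (A₂₃_ne_zero_of_irreducible hq hS' rfl hne)
  obtain ⟨e, hv, hu, hd⟩ := assemble_eq_normalForm hne (hc'.quadratic hq)
  refine ⟨u, v, e ▸ hc.trans hc', hne, ?_, hv, hu, hd⟩
  obtain ⟨g₁, g₂, g₃, hg⟩ := hc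
  rw [← h.diagonalizable.trace, ← trace_assemble, hg, Matrix.trace_mul_comm, ← mul_assoc,
    blockDiag_inv_mul, one_mul]

end Canonical

/-! ### The two types -/

section Types

variable {n : ℕ} {ρ₁ ρ₂ γ : ℂ}

lemma canonicalIIStar_A (t : Fin 3 → ℂ) (ht : Function.Injective t) (α : Fin n → ℂ)
    (β : Fin (n - 1) → ℂ) :
    (canonicalIIStar t ht α β γ ρ₁ ρ₂).A =
      canonicalMatrix ρ₁ ρ₂ γ α β (fun i => (α i - ρ₁) * (α i - ρ₂)) fun _ => 1 := by
  simp only [canonicalIIStar, canonicalMatrix, one_mul]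
  congr 1
  funext j
  rw [crossResidue, one_mul]

lemma canonicalIIIStar_A (t : Fin 3 → ℂ) (ht : Function.Injective t) (α β : Fin n → ℂ) :
    (canonicalIIIStar t ht α β γ ρ₁ ρ₂).A =
      canonicalMatrix ρ₁ ρ₂ γ α β (fun i => α i - ρ₁) fun j => β j - ρ₁ :=
  rfl

/-- The `n` equations for the `n - 1` unknowns `v j` determine `v`, with no extra root. The `n - 1`
equations for `u` do not suffice, so `u` comes from the diagonal of the (1,1) block. -/
lemma IsTypeIIStar.isExpressedAs_canonical (hn : 1 ≤ n) {α : Fin n → ℂ} {β : Fin (n - 1) → ℂ}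
    {S : OkuboSystem n (n - 1) 1} (h : S.IsTypeIIStar α β γ ρ₁ ρ₂) :
    S.IsExpressedAs (canonicalIIStar S.t S.t_injective α β γ ρ₁ ρ₂) := by
  obtain ⟨u, v, hc, hne, hs, hv, -, hd⟩ := h.exists_isBlockConj_normalForm
  have hα := h.exponents₁.1
  have pf : IsPartialFraction β γ (univ.val.map (fun i => ρ₁ + ρ₂ - α i) + 0)
      (crossResidue ρ₁ ρ₂ (fun _ => 1) β α) :=
    isPartialFraction_crossResidue h.exponents₂.1 (by simp) (by simp; omega)
      (by rw [hs, Multiset.sum_zero]; ring)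
  have hv' := eq_crossResidue pf h.exponents₂.1 hα (Nat.sub_le n 1) hne hv
  have hu' : u = crossResidue ρ₁ ρ₂ (fun i => (α i - ρ₁) * (α i - ρ₂)) α β := by
    funext i
    have hA' : ∏ k ∈ univ.erase i, (α i - α k) ≠ 0 := prod_ne_zero_iff.2 fun k hk h =>
      (mem_erase.1 hk).1 (hα (sub_eq_zero.1 h)).symm
    have hD := crossResidue_derivative pf (by simp; omega) hne i
    have hdi := hd i
    rw [← hv'] at hD
    set D := 1 + ∑ j, v j / (α i + β j - (ρ₁ + ρ₂)) ^ 2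
    rw [Multiset.map_zero, Multiset.prod_zero, mul_one] at hD
    -- The derivative is nonzero because the points `ρ₁ + ρ₂ - α i` are simple roots, so one can
    -- divide by it.
    have hD0 : D ≠ 0 := fun h0 => hA' (by rw [← hD, h0, zero_mul])
    have h0 : (u i * ∏ k ∈ univ.erase i, (α i - α k) +
        (α i - ρ₁) * (α i - ρ₂) * ∏ j, (α i + β j - ρ₁ - ρ₂)) * D = 0 := by
      linear_combination (∏ k ∈ univ.erase i, (α i - α k)) * hdi + (α i - ρ₁) * (α i - ρ₂) * hD
    rw [crossResidue]
    field_simp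
    linear_combination (mul_eq_zero.1 h0).resolve_right hD0
  refine IsBlockConj.isExpressedAs rfl ?_
  rw [canonicalIIStar_A, canonicalMatrix_eq_normalForm hne, ← hu', ← hv']
  exact hc

/-- There are `n` equations for each of `u` and `v`, so interpolation determines both; the trace
forces the one remaining root of each numerator to be `ρ₁`. -/
lemma IsTypeIIIStar.isExpressedAs_canonical {α β : Fin n → ℂ}
    {S : OkuboSystem n n 1} (h : S.IsTypeIIIStar α β γ ρ₁ ρ₂) :
    S.IsExpressedAs (canonicalIIIStar S.t S.t_injective α β γ ρ₁ ρ₂) := by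
  obtain ⟨u, v, hc, hne, hs, hv, hu, -⟩ := h.exists_isBlockConj_normalForm
  have hα := h.exponents₁.1
  have hβ := h.exponents₂.1
  have hs' : ∑ i, α i + ∑ j, β j + γ = n * (ρ₁ + ρ₂) + ({ρ₁} : Multiset ℂ).sum := by
    rw [hs, Multiset.sum_singleton]
    push_cast
    ring
  have pf : IsPartialFraction β γ (univ.val.map (fun i => ρ₁ + ρ₂ - α i) + {ρ₁})
      (crossResidue ρ₁ ρ₂ (fun j => β j - ρ₁) β α) :=
    isPartialFraction_crossResidue hβ (by simp) (by simp) hs'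
  have pf' : IsPartialFraction α γ (univ.val.map (fun i => ρ₁ + ρ₂ - β i) + {ρ₁})
      (crossResidue ρ₁ ρ₂ (fun j => α j - ρ₁) α β) :=
    isPartialFraction_crossResidue hα (by simp) (by simp) (by rw [← hs']; ring)
  refine IsBlockConj.isExpressedAs rfl ?_
  rw [canonicalIIIStar_A, canonicalMatrix_eq_normalForm hne,
    ← eq_crossResidue pf hβ hα le_rfl hne hv,
    ← eq_crossResidue pf' hα hβ le_rfl (fun j i => by rw [add_comm]; exact hne i j) hu]
  exact hc

end Types

end OkuboSystem

theorem theorem3p1 (n : ℕ) (hn : 1 ≤ n) (γ ρ₁ ρ₂ : ℂ) :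
    (∀ (α : Fin n → ℂ) (β : Fin (n - 1) → ℂ),
      (∀ S : OkuboSystem n (n - 1) 1, S.IsTypeIIStar α β γ ρ₁ ρ₂ →
        S.IsExpressedAs (OkuboSystem.canonicalIIStar S.t S.t_injective α β γ ρ₁ ρ₂)) ∧
      (∀ (t : Fin 3 → ℂ) (ht : Function.Injective t),
        (OkuboSystem.canonicalIIStar t ht α β γ ρ₁ ρ₂).IsTypeIIStar α β γ ρ₁ ρ₂ ↔
          Function.Injective α ∧ Function.Injective β ∧ ρ₁ ≠ ρ₂ ∧ ρ₁ ≠ 0 ∧ ρ₂ ≠ 0 ∧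
          (∑ i, α i) + (∑ j, β j) + γ = n * ρ₁ + n * ρ₂ ∧
          (∀ i, α i ≠ ρ₁ ∧ α i ≠ ρ₂) ∧ ∀ i j, α i + β j ≠ ρ₁ + ρ₂)) ∧
    (∀ α β : Fin n → ℂ,
      (∀ S : OkuboSystem n n 1, S.IsTypeIIIStar α β γ ρ₁ ρ₂ →
        S.IsExpressedAs (OkuboSystem.canonicalIIIStar S.t S.t_injective α β γ ρ₁ ρ₂)) ∧
      (∀ (t : Fin 3 → ℂ) (ht : Function.Injective t),
        (OkuboSystem.canonicalIIIStar t ht α β γ ρ₁ ρ₂).IsTypeIIIStar α β γ ρ₁ ρ₂ ↔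
          Function.Injective α ∧ Function.Injective β ∧ ρ₁ ≠ ρ₂ ∧ ρ₁ ≠ 0 ∧ ρ₂ ≠ 0 ∧
          (∑ i, α i) + (∑ j, β j) + γ = (n + 1) * ρ₁ + n * ρ₂ ∧
          (∀ i, α i ≠ ρ₁) ∧ (∀ j, β j ≠ ρ₁) ∧ ∀ i j, α i + β j ≠ ρ₁ + ρ₂)) := by
  refine ⟨fun α β => ⟨fun S hS => hS.isExpressedAs_canonical hn, fun t ht => ⟨fun h => ?_, ?_⟩⟩,
    fun α β => ⟨fun S hS => hS.isExpressedAs_canonical, fun t ht => ⟨fun h => ?_, ?_⟩⟩⟩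
  · obtain ⟨hα, hβ, hρ, h₁, h₂, hs, ha, -, hne⟩ :=
      h.canonical_conditions (OkuboSystem.canonicalIIStar_A t ht α β) hn hn hn
    refine ⟨hα, hβ, hρ, h₁, h₂, hs, fun i => ?_, hne⟩
    have := mul_ne_zero_iff.1 (ha i)
    exact ⟨sub_ne_zero.1 this.1, sub_ne_zero.1 this.2⟩
  · rintro ⟨hα, hβ, hρ, h₁, h₂, hs, ha, hne⟩
    have hn' : ((n - 1 : ℕ) : ℂ) = n - 1 := by rw [Nat.cast_sub hn, Nat.cast_one]
    -- The prefactors `(α i - ρ₁) (α i - ρ₂)` and 1 have the root multisets `{ρ₁, ρ₂}` and `0`,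
    -- filling up `(n - 1) + 2 = n + 1` and `n + 0 = (n - 1) + 1` roots.
    refine OkuboSystem.hasType_of_canonical hn (OkuboSystem.canonicalIIStar_A t ht α β)
      (Ea := {ρ₁, ρ₂}) (Eb := 0) (by simp) (by simp) (by simp; omega) (by simp; omega) ?_ ?_
      (by simp) hα hβ hρ h₁ h₂ (by omega) hs
      (fun i => mul_ne_zero (sub_ne_zero.2 (ha i).1) (sub_ne_zero.2 (ha i).2)) (by simp) hne
    · rw [hs, hn']
      simp
      ring
    · rw [hs]
      simp
      ring
  · obtain ⟨hα, hβ, hρ, h₁, h₂, hs, ha, hb, hne⟩ :=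
      h.canonical_conditions (OkuboSystem.canonicalIIIStar_A t ht α β) hn n.succ_pos hn
    exact ⟨hα, hβ, hρ, h₁, h₂, by rw [hs]; push_cast; ring, fun i => sub_ne_zero.1 (ha i),
      fun j => sub_ne_zero.1 (hb j), hne⟩
  · rintro ⟨hα, hβ, hρ, h₁, h₂, hs, ha, hb, hne⟩
    have hs' : ∑ i, α i + ∑ j, β j + γ = n * (ρ₁ + ρ₂) + ({ρ₁} : Multiset ℂ).sum := by
      rw [hs, Multiset.sum_singleton]
      ring
    refine OkuboSystem.hasType_of_canonical hn (OkuboSystem.canonicalIIIStar_A t ht α β)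
      (Ea := {ρ₁}) (Eb := {ρ₁}) (by simp) (by simp) (by simp) (by simp) hs' hs'
      (fun i => ?_) hα hβ hρ h₁ h₂ (by omega) (by rw [hs]; push_cast; ring)
      (fun i => sub_ne_zero.2 (ha i)) (fun j => sub_ne_zero.2 (hb j)) hne
    -- With the single extra root `ρ₁`, the factor `α i + ρ₁ - ρ₁ - ρ₂` supplies the missing `α i -
    -- ρ₂`.
    simp only [Multiset.map_singleton, Multiset.prod_singleton]
    ring
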